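/- Let $n\ge 0$ be an integer, let $A\subset\mathbb Z^{n+1}$ be a nonempty finite set with convex hull $\Delta\subset\mathbb R^{n+1}$, and let $v\colon A\to\mathbb R$ be a function. Let $$L_v\colon\mathbb R^{n+1}\to\mathbb R,\qquad L_v(y)=\max_{x\in A}\,(x\cdot y-v(x)),$$ be its Legendre transform and let $\Pi\subset\mathbb R^{n+1}$ be the corner locus of $L_v$, i.e. the set of points at which $L_v$ is not smooth. Let $\mathcal D_v$ be the lattice subdivision of $\Delta$ whose cells are the projections to $\mathbb R^{n+1}$ of the nonempty bounded faces of the convex hull of $$\{(x,t)\in A\times\mathbb R \mid t\ge v(x)\}\subset\mathbb R^{n+1}\times\mathbb R .$$ Suppose that $\Pi$ is a maximal dual $\Delta$-complex, i.e. that $\mathcal D_v$ is a unimodular triangulation: every cell of $\mathcal D_v$ that is maximal under inclusion is an $(n+1)$-dimensional simplex of volume $\frac1{(n+1)!}$. Then the set $\operatorname{Int}\Delta\cap\mathbb Z^{n+1}$ is finite, and $\Pi$ is homotopy equivalent to the bouquet (wedge) of $\#(\operatorname{Int}\Delta\cap\mathbb Z^{n+1})$ copies of the sphere $S^n$ (a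 single point if this number is $0$). -/

import Mathlib

open scoped ContDiff

namespace TropicalComplex

/-- The real vector space `ℝ^(n+1)`, with its standard scalar product. -/
abbrev E (n : ℕ) : Type := EuclideanSpace ℝ (Fin (n + 1))

/-- The lattice point `a ∈ ℤ^(n+1)`, seen in `ℝ^(n+1)`. -/
noncomputable def latticePoint {n : ℕ} (a : Fin (n + 1) → ℤ) : E n :=
  WithLp.toLp 2 (fun i => (a i : ℝ))

/-- The convex hull `Δ ⊆ ℝ^(n+1)` of a finite set `A ⊆ ℤ^(n+1)`. -/
noncomputable def newtonPolyhedron {n : ℕ} (A : Finset (Fin (n + 1) → ℤ)) : Set (E n) :=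
  convexHull ℝ (latticePoint '' (A : Set (Fin (n + 1) → ℤ)))

/-- The Legendre transform `L_v(y) = max_{x ∈ A} (x · y - v(x))`.
Only the values of `v` on `A` are used. -/
noncomputable def legendre {n : ℕ} (A : Finset (Fin (n + 1) → ℤ)) (hA : A.Nonempty)
    (v : (Fin (n + 1) → ℤ) → ℝ) (y : E n) : ℝ :=
  A.sup' hA (fun a => inner ℝ (latticePoint a) y - v a)

/-- The corner locus of a function: the set of points where it is not smooth. -/
def cornerLocus {n : ℕ} (f : E n → ℝ) : Set (E n) :=
  {y | ¬ ContDiffAt ℝ ∞ f y}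

/-- The overgraph of `v : A → ℝ`: the union of the vertical rays upwards in `ℝ^(n+1) × ℝ`
starting at the points of the graph of `v`. -/
def overgraph {n : ℕ} (A : Finset (Fin (n + 1) → ℤ)) (v : (Fin (n + 1) → ℤ) → ℝ) :
    Set (E n × ℝ) :=
  {p | ∃ a ∈ A, p.1 = latticePoint a ∧ v a ≤ p.2}

/-- The lattice subdivision `𝓓_v` of `Δ` determined by `v`, as the set of its closed cells of all
dimensions: the projections to `ℝ^(n+1)` of the (nonempty) bounded faces of the convex hull of the
overgraph. The faces of this polyhedron are its exposed subsets. -/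
def subdivision {n : ℕ} (A : Finset (Fin (n + 1) → ℤ)) (v : (Fin (n + 1) → ℤ) → ℝ) :
    Set (Set (E n)) :=
  {C | ∃ F : Set (E n × ℝ), IsExposed ℝ (convexHull ℝ (overgraph A v)) F ∧ F.Nonempty ∧
    Bornology.IsBounded F ∧ C = Prod.fst '' F}

/-- A simplex of dimension `n + 1` and volume `1 / (n + 1)!` in `ℝ^(n+1)`. -/
def IsUnimodularSimplex {n : ℕ} (C : Set (E n)) : Prop :=
  (∃ s : Affine.Simplex ℝ (E n) (n + 1), C = convexHull ℝ (Set.range s.points)) ∧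
    MeasureTheory.volume C = ENNReal.ofReal (1 / ((n + 1).factorial : ℝ))

/-- A collection of cells is a unimodular triangulation if the pieces, i.e. the cells not contained
in a larger cell, are unimodular simplices. -/
def IsUnimodular {n : ℕ} (D : Set (Set (E n))) : Prop :=
  ∀ C, Maximal (· ∈ D) C → IsUnimodularSimplex C

/-- `P` is a maximal dual `Δ`-complex: `P = Π_v` is the corner locus of the Legendre transform of a
function `v` on a nonempty finite set `A` of lattice points with convex hull `Δ`, and the
subdivision of `Δ` corresponding to `v` is a unimodular triangulation. -/
def IsMaximalDualComplex {n : ℕ} (Δ P : Set (E n)) : Prop :=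
  ∃ (A : Finset (Fin (n + 1) → ℤ)) (hA : A.Nonempty) (v : (Fin (n + 1) → ℤ) → ℝ),
    Δ = newtonPolyhedron A ∧ P = cornerLocus (legendre A hA v) ∧ IsUnimodular (subdivision A v)

/-- The points of `ℤ^(n+1)` in the interior of `Δ`. -/
def interiorLatticePoints {n : ℕ} (Δ : Set (E n)) : Set (Fin (n + 1) → ℤ) :=
  {a | latticePoint a ∈ interior Δ}

/-- The unit sphere `S^n ⊆ ℝ^(n+1)`. -/
abbrev Sphere (n : ℕ) : Type := Metric.sphere (0 : E n) 1

/-- The base point `(1, 0, …, 0)` of `S^n`. -/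
noncomputable def Sphere.base (n : ℕ) : Sphere n :=
  ⟨EuclideanSpace.single 0 1, by simp⟩

/-- The identifications in the disjoint union of a point and `k` copies of `S^n` that define the
bouquet: the base points of all the copies are glued to the point. -/
def bouquetRel (n k : ℕ) (x y : Unit ⊕ (Fin k × Sphere n)) : Prop :=
  ∃ i : Fin k, x = Sum.inr (i, Sphere.base n) ∧ y = Sum.inl ()

/-- The bouquet (wedge) of `k` copies of `S^n`, with the quotient topology; a point if `k = 0`. -/
abbrev Bouquet (n k : ℕ) : Type := Quot (bouquetRel n k)

end TropicalComplex

/-!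
The terms `a · y - v a` of the Legendre transform cut `ℝ^(n+1)` into closed convex regions, one for
each `a ∈ A`, and the corner locus `Π` is the union of the intersections of two different regions
(`mem_cornerLocus_iff`). The bouquet is reached from `Π` through the complement of finitely many
points.

*All lattice points of `Δ` have a region with nonempty interior* (`mem_and_nonempty_openRegion`).
The cells of the subdivision are the convex hulls of the sets of those `a` that attain the maximum at
a given point `y` (`dualCell_mem_subdivision`, `exists_eq_dualCell`), and they cover `Δ`. By
unimodularity, the edges from a vertex of a maximal cell form a basis of the lattice
(`isUnit_det_edgeMatrix`), so a lattice point of this cell is one of its vertices, and its term can be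
made larger than all the others by a small change of `y`.

*From `Π` to the complement of points* (`nonempty_homotopyEquiv_cornerLocus`). For each lattice point
`a` in the interior of `Δ` let `p a` be a point in the interior of its region. The complement of these
points retracts onto `Π`, region by region. In the region of an interior lattice point, which is
bounded, points move away from `p a` until they reach the boundary. For a lattice point on the
boundary of `Δ`, the region contains a ray in the direction of a functional that is maximal on `Δ` at
`a`; points move away from a centre that lies far out in this direction, and how far depends on the
point, so that the boundary is always reached.

*From the complement of points to the bouquet*
(`SeparatedPoints.nonempty_homotopyEquiv_bouquet`). After an inversion at the origin, the space
becomes the one-point compactification of `ℝ^(n+1)` without the inverted points and without the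
origin. For generic `p a` the zeroth coordinates of the inverted points are positive and different,
so parallel hyperplanes separate these points and the origin from each other. In each layer between
two neighbouring hyperplanes the complement of the point retracts onto the two hyperplanes and the
point at infinity by dilations from the removed point. Inverted back, the hyperplanes are spheres
that touch each other at the origin, and their union is the bouquet.
-/

namespace TropicalComplex

/-! ### Deformation retractions that are given cell by cell -/

/-- A subspace `W` is homotopy equivalent to `S` if it is a deformation retract; only the final map
has to fix the points of `W`. -/
theorem nonempty_homotopyEquiv_of_deformation {X : Type*} [TopologicalSpace X] {S W : Set X}
    (hWS : W ⊆ S) (H : unitInterval × S → S) (hH : Continuous H)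
    (h0 : ∀ y, H (0, y) = y) (h1 : ∀ y, (H (1, y) : X) ∈ W)
    (hW : ∀ y : S, (y : X) ∈ W → H (1, y) = y) :
    Nonempty (ContinuousMap.HomotopyEquiv W S) := by
  let ι : C(W, S) := ⟨Set.inclusion hWS, continuous_inclusion hWS⟩
  let r : C(S, W) := ⟨fun y => ⟨H (1, y), h1 y⟩, by fun_prop⟩
  refine ⟨⟨ι, r, ?_, ?_⟩⟩
  · have : r.comp ι = ContinuousMap.id W := by
      ext x
      change ((H (1, ι x) : S) : X) = x
      rw [hW (ι x) x.2]
      rfl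
    rw [this]
  · refine ContinuousMap.Homotopic.symm ⟨⟨⟨H, hH⟩, ?_, ?_⟩⟩
    · intro x; exact h0 x
    · intro x; rfl

/-- Homotopies `H j` of the pieces `S ∩ Z j` of `S` that push each piece into `W` and keep the points
of `W` fixed fit together, since two different pieces only meet in `W`. -/
theorem nonempty_homotopyEquiv_of_cells {X J : Type*} [TopologicalSpace X] [Finite J]
    {S W : Set X} (hWS : W ⊆ S) (Z : J → Set X) (hZ : ∀ j, IsClosed (Z j))
    (hcov : ∀ y ∈ S, ∃ j, y ∈ Z j) (hover : ∀ i j, i ≠ j → S ∩ Z i ∩ Z j ⊆ W)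
    (H : J → ℝ → X → X)
    (hcont : ∀ j, ContinuousOn (fun q : ℝ × X => H j q.1 q.2) (Set.Icc 0 1 ×ˢ (S ∩ Z j)))
    (hmaps : ∀ j, ∀ s ∈ Set.Icc (0 : ℝ) 1, ∀ y ∈ S ∩ Z j, H j s y ∈ S)
    (h0 : ∀ j, ∀ y ∈ S ∩ Z j, H j 0 y = y) (h1 : ∀ j, ∀ y ∈ S ∩ Z j, H j 1 y ∈ W)
    (hW : ∀ j, ∀ s, ∀ y ∈ W ∩ Z j, H j s y = y) :
    Nonempty (ContinuousMap.HomotopyEquiv W S) := by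
  classical
  choose sel hsel using fun y : S => hcov y y.2
  let G : unitInterval × S → S := fun q =>
    ⟨H (sel q.2) q.1 q.2, hmaps _ _ q.1.2 _ ⟨q.2.2, hsel q.2⟩⟩
  have hG : ∀ (q : unitInterval × S) (j : J), (q.2 : X) ∈ Z j → (G q : X) = H j q.1 q.2 := by
    intro q j hj
    by_cases hij : sel q.2 = j
    · subst hij; rfl
    · have hw : (q.2 : X) ∈ W := hover _ _ hij ⟨⟨q.2.2, hsel q.2⟩, hj⟩
      change H (sel q.2) q.1 q.2 = _
      rw [hW _ _ _ ⟨hw, hsel q.2⟩, hW _ _ _ ⟨hw, hj⟩]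
  refine nonempty_homotopyEquiv_of_deformation hWS G ?_ ?_ ?_ ?_
  · have hproj : Continuous fun q : unitInterval × S => (q.2 : X) := by fun_prop
    refine (locallyFinite_of_finite fun j => (fun q : unitInterval × S => (q.2 : X)) ⁻¹' Z j).continuous
      ?_ (fun j => (hZ j).preimage hproj) fun j => ?_
    · exact Set.eq_univ_of_forall fun q => Set.mem_iUnion.2 ⟨sel q.2, hsel q.2⟩
    · rw [Topology.IsInducing.subtypeVal.continuousOn_iff]
      have hc : ContinuousOn (fun q : unitInterval × S => H j q.1 q.2)
          ((fun q : unitInterval × S => (q.2 : X)) ⁻¹' Z j) :=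
        (hcont j).comp (f := fun q : unitInterval × S => ((q.1 : ℝ), (q.2 : X)))
          (by fun_prop) fun q hq => ⟨q.1.2, q.2.2, hq⟩
      exact hc.congr fun q hq => hG q j hq
  · intro y; exact Subtype.ext (h0 _ _ ⟨y.2, hsel y⟩)
  · intro y; exact h1 _ _ ⟨y.2, hsel y⟩
  · intro y hy; exact Subtype.ext (hW _ _ _ ⟨hy, hsel y⟩)

/-- The smallest of `1` and the quotients `α i / β i`. If `α i` and `β i > 0` are the values of affine
functions at a point `y` and at a centre `c`, then the dilation with centre `c` and factor
`1 / (1 - clippedRatio α β)` takes `y` to the boundary of the polyhedron on which all these functions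
are nonnegative; the value `1` means that the ray from `c` through `y` never leaves it. -/
noncomputable def clippedRatio {ι : Type*} [Fintype ι] (α β : ι → ℝ) : ℝ :=
  (Finset.univ : Finset (Option ι)).inf' ⟨none, Finset.mem_univ _⟩
    fun o => o.elim 1 fun i => α i / β i

section clippedRatio

variable {ι : Type*} [Fintype ι] {α β : ι → ℝ}

theorem clippedRatio_le_one : clippedRatio α β ≤ 1 :=
  Finset.inf'_le (fun o : Option ι => o.elim 1 fun i => α i / β i) (Finset.mem_univ none)

theorem clippedRatio_mul_le (hβ : ∀ i, 0 < β i) (i : ι) : clippedRatio α β * β i ≤ α i := by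
  rw [← le_div_iff₀ (hβ i)]
  exact Finset.inf'_le (fun o : Option ι => o.elim 1 fun i => α i / β i) (Finset.mem_univ (some i))

theorem clippedRatio_nonneg (hβ : ∀ i, 0 < β i) (hα : ∀ i, 0 ≤ α i) : 0 ≤ clippedRatio α β := by
  refine (Finset.le_inf'_iff _ _).2 fun o _ => ?_
  cases o with
  | none => exact zero_le_one
  | some i => exact div_nonneg (hα i) (hβ i).le

theorem clippedRatio_eq_one_or (hβ : ∀ i, 0 < β i) :
    clippedRatio α β = 1 ∨ ∃ i, clippedRatio α β * β i = α i := by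
  obtain ⟨o, -, ho⟩ := Finset.exists_mem_eq_inf' (s := (Finset.univ : Finset (Option ι)))
    ⟨none, Finset.mem_univ _⟩ fun o => o.elim 1 fun i => α i / β i
  cases o with
  | none => exact Or.inl ho
  | some i =>
    refine Or.inr ⟨i, ?_⟩
    change clippedRatio α β = α i / β i at ho
    rw [ho, div_mul_cancel₀ _ (hβ i).ne']

theorem clippedRatio_lt_one (hβ : ∀ i, 0 < β i) {i : ι} (h : α i < β i) :
    clippedRatio α β < 1 := by
  have := clippedRatio_mul_le (α := α) hβ i
  by_contra hc
  nlinarith [hβ i, not_lt.1 hc]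

theorem clippedRatio_eq_zero (hβ : ∀ i, 0 < β i) (hα : ∀ i, 0 ≤ α i) {i : ι} (h : α i = 0) :
    clippedRatio α β = 0 := by
  have h1 := clippedRatio_mul_le (α := α) hβ i
  have h2 := clippedRatio_nonneg hβ hα
  rw [h] at h1
  exact le_antisymm (nonpos_of_mul_nonpos_left h1 (hβ i)) h2

theorem continuousOn_clippedRatio {X : Type*} [TopologicalSpace X] {s : Set X} {α β : X → ι → ℝ}
    (hα : ∀ i, ContinuousOn (fun x => α x i) s) (hβ : ∀ i, ContinuousOn (fun x => β x i) s)
    (h : ∀ x i, 0 < β x i) : ContinuousOn (fun x => clippedRatio (α x) (β x)) s := by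
  refine ContinuousOn.finset_inf'_apply _ fun o _ => ?_
  cases o with
  | none => exact continuousOn_const
  | some i => exact (hα i).div (hβ i) fun x _ => (h x i).ne'

end clippedRatio

/-! ### The complement of finitely many points is a bouquet -/

section Inversion

variable {V : Type*} [NormedAddCommGroup V] [NormedSpace ℝ V]

/-- The inversion in the unit sphere, with the junk value `0` at `0`. -/
noncomputable def unitInversion (y : V) : V := (‖y‖ ^ 2)⁻¹ • y

@[simp] theorem unitInversion_zero : unitInversion (0 : V) = 0 := by simp [unitInversion]

theorem norm_unitInversion (y : V) : ‖unitInversion y‖ = ‖y‖⁻¹ := by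
  by_cases hy : y = 0
  · simp [hy]
  · have : ‖y‖ ≠ 0 := norm_ne_zero_iff.2 hy
    rw [unitInversion, norm_smul, norm_inv, norm_pow, norm_norm]
    field_simp

@[simp] theorem unitInversion_eq_zero {y : V} : unitInversion y = 0 ↔ y = 0 := by
  rw [← norm_eq_zero, norm_unitInversion, inv_eq_zero, norm_eq_zero]

@[simp] theorem unitInversion_unitInversion (y : V) : unitInversion (unitInversion y) = y := by
  by_cases hy : y = 0
  · simp [hy]
  · have : ‖y‖ ≠ 0 := norm_ne_zero_iff.2 hy
    rw [unitInversion, norm_unitInversion, unitInversion, smul_smul]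
    have : (‖y‖⁻¹ ^ 2)⁻¹ * (‖y‖ ^ 2)⁻¹ = 1 := by field_simp
    rw [this, one_smul]

theorem unitInversion_smul (a : ℝ) (y : V) : unitInversion (a • y) = a⁻¹ • unitInversion y := by
  by_cases ha : a = 0
  · simp [ha]
  · rw [unitInversion, unitInversion, norm_smul, smul_smul, smul_smul, mul_pow, Real.norm_eq_abs,
      sq_abs]
    congr 1
    by_cases hy : ‖y‖ = 0
    · simp [hy]
    · field_simp

theorem continuousAt_unitInversion {y : V} (hy : y ≠ 0) : ContinuousAt (unitInversion (V := V)) y := by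
  have : ‖y‖ ^ 2 ≠ 0 := pow_ne_zero _ (norm_ne_zero_iff.2 hy)
  unfold unitInversion
  exact ((continuous_norm.pow 2).continuousAt.inv₀ this).smul continuousAt_id

end Inversion

variable {n : ℕ}

theorem unitInversion_apply_zero (y : E n) : unitInversion y 0 = (‖y‖ ^ 2)⁻¹ * y 0 := rfl

/-- Points `p i` whose inversions have increasing positive zeroth coordinates, separated from each
other and from `0` by numbers `h i`. -/
structure SeparatedPoints (n k : ℕ) where
  /-- the points -/
  p : Fin k → E n
  /-- the separating heights -/
  h : Fin k → ℝ
  h_pos : ∀ i, 0 < h i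
  h_lt : ∀ i, h i < unitInversion (p i) 0
  lt_h : ∀ i j, i < j → unitInversion (p i) 0 < h j

namespace SeparatedPoints

variable {k : ℕ} (D : SeparatedPoints n k)

/-- The inversions of the points, together with the origin, which is the inversion of the point at
infinity. -/
noncomputable def center (o : Option (Fin k)) : E n := o.elim 0 fun i => unitInversion (D.p i)

/-- The union of the spheres through the origin that are the inversions of the hyperplanes
`z 0 = h i`. -/
def spheres : Set (E n) := {y | y = 0 ∨ ∃ i, y 0 = D.h i * ‖y‖ ^ 2}

/-- The inversion of the layer between two consecutive hyperplanes `z 0 = h i` that contains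
`center o`, with the origin added. -/
def layer (o : Option (Fin k)) : Set (E n) :=
  {y | ∀ i, 0 ≤ (y 0 - D.h i * ‖y‖ ^ 2) * (D.center o 0 - D.h i)}

theorem h_strictMono : StrictMono D.h := fun i j hij => (D.h_lt i).trans (D.lt_h i j hij)

theorem p_ne_zero (i : Fin k) : D.p i ≠ 0 := by
  intro h
  have h1 := D.h_lt i
  have h2 := D.h_pos i
  rw [h, unitInversion_zero] at h1
  exact lt_asymm h1 h2

theorem center_lt {o : Option (Fin k)} {i : Fin k} (h : ∀ j, o = some j → j < i) :
    D.center o 0 < D.h i := by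
  cases o with
  | none => exact D.h_pos i
  | some j => exact D.lt_h j i (h j rfl)

theorem lt_center {j i : Fin k} (h : i ≤ j) : D.h i < D.center (some j) 0 :=
  (D.h_strictMono.monotone h).trans_lt (D.h_lt j)

theorem center_ne (o : Option (Fin k)) (i : Fin k) : D.center o 0 - D.h i ≠ 0 := by
  rw [sub_ne_zero]
  cases o with
  | none => exact (D.center_lt (by simp)).ne
  | some j =>
    rcases lt_or_ge j i with h | h
    · refine (D.center_lt ?_).ne
      rintro _ ⟨⟩
      exact h
    · exact (D.lt_center h).ne'

/-- Two different centres are separated by one of the hyperplanes. -/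
theorem exists_separating {o o' : Option (Fin k)} (h : o ≠ o') :
    ∃ i, (D.center o 0 - D.h i) * (D.center o' 0 - D.h i) < 0 := by
  have key : ∀ (o : Option (Fin k)) (j : Fin k), (∀ i, o = some i → i < j) →
      (D.center o 0 - D.h j) * (D.center (some j) 0 - D.h j) < 0 := fun o j hj =>
    mul_neg_of_neg_of_pos (sub_neg.2 (D.center_lt hj)) (sub_pos.2 (D.lt_center le_rfl))
  cases o with
  | none =>
    cases o' with
    | none => exact absurd rfl h
    | some j => exact ⟨j, key _ _ (by simp)⟩
  | some j =>
    cases o' with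
    | none => exact ⟨j, by rw [mul_comm]; exact key _ _ (by simp)⟩
    | some j' =>
      rcases lt_trichotomy j j' with hlt | rfl | hlt
      · refine ⟨j', key _ _ ?_⟩
        rintro _ ⟨⟩
        exact hlt
      · exact absurd rfl h
      · refine ⟨j, ?_⟩
        rw [mul_comm]
        refine key _ _ ?_
        rintro _ ⟨⟩
        exact hlt

theorem exists_mem_layer (y : E n) : ∃ o, y ∈ D.layer o := by
  classical
  let s : Finset (Fin k) := Finset.univ.filter fun i => D.h i * ‖y‖ ^ 2 ≤ y 0
  rcases s.eq_empty_or_nonempty with hs | hs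
  · refine ⟨none, fun i => ?_⟩
    have hi : i ∉ s := by simp [hs]
    have hi' : y 0 < D.h i * ‖y‖ ^ 2 := by simpa [s] using hi
    exact mul_nonneg_of_nonpos_of_nonpos (sub_neg.2 hi').le
      (sub_neg.2 (D.center_lt (by simp))).le
  · refine ⟨some (s.max' hs), fun i => ?_⟩
    rcases le_or_gt i (s.max' hs) with hi | hi
    · have h1 : D.h (s.max' hs) * ‖y‖ ^ 2 ≤ y 0 := (Finset.mem_filter.1 (s.max'_mem hs)).2
      have h2 : D.h i * ‖y‖ ^ 2 ≤ D.h (s.max' hs) * ‖y‖ ^ 2 :=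
        mul_le_mul_of_nonneg_right (D.h_strictMono.monotone hi) (sq_nonneg _)
      exact mul_nonneg (sub_nonneg.2 (h2.trans h1)) (sub_pos.2 (D.lt_center hi)).le
    · have hi' : i ∉ s := fun h => absurd (s.le_max' i h) (not_le.2 hi)
      have hi'' : y 0 < D.h i * ‖y‖ ^ 2 := by simpa [s] using hi'
      refine mul_nonneg_of_nonpos_of_nonpos (sub_neg.2 hi'').le (sub_neg.2 (D.center_lt ?_)).le
      rintro _ ⟨⟩
      exact hi

theorem isClosed_layer (o : Option (Fin k)) : IsClosed (D.layer o) := by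
  have : D.layer o = ⋂ i, {y | 0 ≤ (y 0 - D.h i * ‖y‖ ^ 2) * (D.center o 0 - D.h i)} := by
    ext y; simp [layer]
  rw [this]
  exact isClosed_iInter fun i => isClosed_le continuous_const (by fun_prop)

theorem layer_inter_layer_subset {o o' : Option (Fin k)} (h : o ≠ o') :
    D.layer o ∩ D.layer o' ⊆ D.spheres := by
  rintro y ⟨h1, h2⟩
  obtain ⟨i, hi⟩ := D.exists_separating h
  have h3 := mul_nonneg (h1 i) (h2 i)
  have h4 : (y 0 - D.h i * ‖y‖ ^ 2) ^ 2 ≤ 0 := by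
    by_contra hc
    nlinarith [mul_neg_of_pos_of_neg (not_le.1 hc) hi]
  have h5 : y 0 - D.h i * ‖y‖ ^ 2 = 0 := by
    rw [← sq_eq_zero_iff]; exact le_antisymm h4 (sq_nonneg _)
  exact Or.inr ⟨i, sub_eq_zero.1 h5⟩

/-- The condition on the inverted point `z` that corresponds to `layer`. -/
theorem unitInversion_mem_layer {o : Option (Fin k)} {z : E n} (hz : z ≠ 0) :
    unitInversion z ∈ D.layer o ↔ ∀ i, 0 ≤ (z 0 - D.h i) * (D.center o 0 - D.h i) := by
  have h : 0 < (‖z‖ ^ 2)⁻¹ := inv_pos.2 (pow_pos (norm_pos_iff.2 hz) 2)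
  refine forall_congr' fun i => ?_
  rw [norm_unitInversion, unitInversion_apply_zero, inv_pow, mul_comm (D.h i), ← mul_sub, mul_assoc,
    mul_nonneg_iff_of_pos_left h]

/-- The clipped ratio, in the inverted picture, for the affine functions that vanish on the hyperplanes
`z 0 = h i`, with signs that make them positive at the centre. It is `0` on the boundary of the layer
and `1` on the rays from the centre that do not reach it. -/
noncomputable def ratio (o : Option (Fin k)) (y : E n) : ℝ :=
  clippedRatio (fun i => (unitInversion y 0 - D.h i) * (D.center o 0 - D.h i))
    (fun i => (D.center o 0 - D.h i) ^ 2)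

/-- In the inverted picture, the dilation with centre `center o` and factor `1 / (1 - s * ratio)`.
For `s = 1` it takes a point to the boundary of its layer, or to infinity, i.e. to `0` in the
picture before inversion. -/
noncomputable def flow (o : Option (Fin k)) (s : ℝ) (y : E n) : E n :=
  if y = 0 then 0 else
    (1 - s * D.ratio o y) • unitInversion (unitInversion y - (s * D.ratio o y) • D.center o)

theorem sq_center_pos (o : Option (Fin k)) (i : Fin k) : 0 < (D.center o 0 - D.h i) ^ 2 :=
  sq_pos_of_ne_zero (D.center_ne o i)

variable {D} {o : Option (Fin k)} {y : E n}

theorem mem_layer_iff (hy : y ≠ 0) : y ∈ D.layer o ↔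
    ∀ i, 0 ≤ (unitInversion y 0 - D.h i) * (D.center o 0 - D.h i) := by
  rw [← D.unitInversion_mem_layer (unitInversion_eq_zero.not.2 hy), unitInversion_unitInversion]

theorem ratio_nonneg (hy : y ≠ 0) (hyo : y ∈ D.layer o) : 0 ≤ D.ratio o y :=
  clippedRatio_nonneg (D.sq_center_pos o) ((mem_layer_iff hy).1 hyo)

theorem ratio_le_one : D.ratio o y ≤ 1 := clippedRatio_le_one

theorem unitInversion_center_mem (ho : D.center o ≠ 0) :
    unitInversion (D.center o) ∈ Set.range D.p := by
  cases o with
  | none => exact absurd rfl ho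
  | some i => exact ⟨i, by simp [center]⟩

theorem center_eq_zero_iff : D.center o = 0 ↔ o = none := by
  cases o with
  | none => simp [center]
  | some i => simp [center, D.p_ne_zero i]

/-- In the inverted picture, the dilated point stays in its layer. -/
theorem dilation_mem {s : ℝ} (hs : s ∈ Set.Icc (0 : ℝ) 1) (hy : y ≠ 0) (hyo : y ∈ D.layer o)
    {w : E n} (hlt : s * D.ratio o y < 1)
    (hw : unitInversion y - (s * D.ratio o y) • D.center o = (1 - s * D.ratio o y) • w) (i : Fin k) :
    0 ≤ (w 0 - D.h i) * (D.center o 0 - D.h i) := by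
  set ρ := s * D.ratio o y
  have h1 : ρ * (D.center o 0 - D.h i) ^ 2 ≤ (unitInversion y 0 - D.h i) * (D.center o 0 - D.h i) :=
    (mul_le_mul_of_nonneg_right (mul_le_of_le_one_left (ratio_nonneg hy hyo) hs.2)
      (sq_nonneg _)).trans (clippedRatio_mul_le (D.sq_center_pos o) i)
  have h2 : unitInversion y 0 - ρ * D.center o 0 = (1 - ρ) * w 0 := congrArg (fun v : E n => v 0) hw
  have h3 : 0 < 1 - ρ := sub_pos.2 hlt
  rw [← mul_nonneg_iff_of_pos_left h3]
  have h4 : (1 - ρ) * ((w 0 - D.h i) * (D.center o 0 - D.h i)) =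
      (unitInversion y 0 - D.h i) * (D.center o 0 - D.h i) - ρ * (D.center o 0 - D.h i) ^ 2 := by
    linear_combination -(D.center o 0 - D.h i) * h2
  rw [h4]
  exact sub_nonneg.2 h1

/-- The outer inversion in the definition of `flow` is never applied to the origin, since the dilations
never reach it: in the inverted picture, the origin lies in the layer of `none` only, and it is the
centre of the dilations of this layer. -/
theorem sub_smul_center_ne_zero {s : ℝ} (hs : s ∈ Set.Icc (0 : ℝ) 1) (hy : y ≠ 0)
    (hyo : y ∈ D.layer o) (hyp : y ∉ Set.range D.p) :
    unitInversion y - (s * D.ratio o y) • D.center o ≠ 0 := by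
  intro h0
  by_cases ho : D.center o = 0
  · rw [ho, smul_zero, sub_zero, unitInversion_eq_zero] at h0
    exact hy h0
  have hle : s * D.ratio o y ≤ 1 := mul_le_one₀ hs.2 (ratio_nonneg hy hyo) ratio_le_one
  rcases hle.eq_or_lt with h1 | h1
  · rw [h1, one_smul, sub_eq_zero] at h0
    refine hyp ?_
    rw [← unitInversion_unitInversion y, h0]
    exact unitInversion_center_mem ho
  · obtain ⟨i, hi⟩ := D.exists_separating (o := none) (o' := o)
      fun h => ho (center_eq_zero_iff.2 h.symm)
    have := dilation_mem hs hy hyo (w := 0) h1 (by rw [h0, smul_zero]) i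
    exact absurd hi (not_lt.2 this)

/-- A point is dilated within its layer, and away from the only removed point of that layer. -/
theorem flow_not_mem_range {s : ℝ} (hs : s ∈ Set.Icc (0 : ℝ) 1)
    (hyo : y ∈ D.layer o) (hyp : y ∉ Set.range D.p) : D.flow o s y ∉ Set.range D.p := by
  have h0 : (0 : E n) ∉ Set.range D.p := fun ⟨i, hi⟩ => D.p_ne_zero i hi
  by_cases hy : y = 0
  · rwa [flow, if_pos hy]
  rw [flow, if_neg hy]
  have hle : s * D.ratio o y ≤ 1 := mul_le_one₀ hs.2 (ratio_nonneg hy hyo) ratio_le_one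
  rcases hle.eq_or_lt with h1 | h1
  · rwa [h1, sub_self, zero_smul]
  · have h2 : 1 - s * D.ratio o y ≠ 0 := (sub_pos.2 h1).ne'
    set w := (1 - s * D.ratio o y)⁻¹ • (unitInversion y - (s * D.ratio o y) • D.center o) with hw
    have hw' : unitInversion y - (s * D.ratio o y) • D.center o = (1 - s * D.ratio o y) • w := by
      rw [hw, smul_inv_smul₀ h2]
    rw [hw', unitInversion_smul, smul_inv_smul₀ h2]
    rintro ⟨i, hi⟩
    have hwi : w = D.center (some i) := by
      rw [← unitInversion_unitInversion w, ← hi]; rfl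
    have hio : some i = o := by
      by_contra hne
      obtain ⟨j, hj⟩ := D.exists_separating hne
      have := dilation_mem hs hy hyo h1 hw' j
      rw [hwi] at this
      exact absurd hj (not_lt.2 this)
    rw [hwi, hio, sub_smul, one_smul, sub_left_inj] at hw'
    refine hyp ⟨i, ?_⟩
    rw [← unitInversion_unitInversion y, hw', ← hio]
    simp [center]

theorem flow_zero : D.flow o 0 y = y := by
  by_cases hy : y = 0
  · rw [flow, if_pos hy, hy]
  · simp [flow, hy]

theorem flow_one_mem : D.flow o 1 y ∈ D.spheres := by
  by_cases hy : y = 0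
  · rw [flow, if_pos hy]; exact Or.inl rfl
  rw [flow, if_neg hy, one_mul]
  by_cases h1 : D.ratio o y = 1
  · rw [h1, sub_self, zero_smul]; exact Or.inl rfl
  have hlt : 0 < 1 - D.ratio o y := sub_pos.2 (lt_of_le_of_ne ratio_le_one h1)
  obtain ⟨i, hi⟩ := (clippedRatio_eq_one_or (D.sq_center_pos o)).resolve_left h1
  change D.ratio o y * _ = _ at hi
  set ρ := D.ratio o y
  set w := (1 - ρ)⁻¹ • (unitInversion y - ρ • D.center o) with hw
  have hw' : unitInversion y - ρ • D.center o = (1 - ρ) • w := by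
    rw [hw, smul_inv_smul₀ hlt.ne']
  rw [hw', unitInversion_smul, smul_inv_smul₀ hlt.ne']
  have h2 : unitInversion y 0 - ρ * D.center o 0 = (1 - ρ) * w 0 := congrArg (fun v : E n => v 0) hw'
  have h3 : unitInversion y 0 - D.h i = ρ * (D.center o 0 - D.h i) := by
    apply mul_right_cancel₀ (D.center_ne o i)
    rw [← hi]; ring
  have h4 : w 0 = D.h i := by
    apply mul_left_cancel₀ hlt.ne'
    linarith
  refine Or.inr ⟨i, ?_⟩
  rw [unitInversion_apply_zero, norm_unitInversion, h4, inv_pow, mul_comm]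

theorem flow_of_mem_spheres (hyW : y ∈ D.spheres) (hyo : y ∈ D.layer o) (s : ℝ) :
    D.flow o s y = y := by
  by_cases hy : y = 0
  · rw [flow, if_pos hy, hy]
  obtain ⟨i, hi⟩ := hyW.resolve_left hy
  have h1 : unitInversion y 0 - D.h i = 0 := by
    have : ‖y‖ ^ 2 ≠ 0 := pow_ne_zero _ (norm_ne_zero_iff.2 hy)
    rw [unitInversion_apply_zero, hi, mul_comm (D.h i), inv_mul_cancel_left₀ this, sub_self]
  have h2 : D.ratio o y = 0 :=
    clippedRatio_eq_zero (D.sq_center_pos o) ((mem_layer_iff hy).1 hyo) (i := i) (by rw [h1, zero_mul])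
  rw [flow, if_neg hy, h2]
  simp

theorem continuousAt_ratio (hy : y ≠ 0) : ContinuousAt (D.ratio o) y := by
  have hopen : IsOpen ({0}ᶜ : Set (E n)) := isOpen_compl_singleton
  have hinv : ContinuousOn (unitInversion : E n → E n) {0}ᶜ := fun x hx =>
    (continuousAt_unitInversion hx).continuousWithinAt
  have hzero : Continuous fun x : E n => x 0 := by fun_prop
  have h0 : ContinuousOn (fun x : E n => unitInversion x 0) {0}ᶜ := hzero.comp_continuousOn hinv
  have h1 : ContinuousOn (fun x : E n => D.ratio o x) {0}ᶜ := by
    unfold ratio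
    exact continuousOn_clippedRatio
      (α := fun (x : E n) i => (unitInversion x 0 - D.h i) * (D.center o 0 - D.h i))
      (β := fun (_ : E n) i => (D.center o 0 - D.h i) ^ 2)
      (fun i => (h0.sub continuousOn_const).mul continuousOn_const)
      (fun i => continuousOn_const) (fun _ i => D.sq_center_pos o i)
  exact h1.continuousAt (hopen.mem_nhds hy)

/-- This bound is the continuity of `flow` at the origin, where its defining expression breaks
down. -/
theorem norm_flow_le {s : ℝ} (hs : s ∈ Set.Icc (0 : ℝ) 1) (hyo : y ∈ D.layer o)
    (hsmall : ‖y‖ * ‖D.center o‖ ≤ 1 / 2) : ‖D.flow o s y‖ ≤ 2 * ‖y‖ := by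
  by_cases hy : y = 0
  · simp [flow, hy]
  have hle : s * D.ratio o y ≤ 1 := mul_le_one₀ hs.2 (ratio_nonneg hy hyo) ratio_le_one
  have hge : 0 ≤ s * D.ratio o y := mul_nonneg hs.1 (ratio_nonneg hy hyo)
  rw [flow, if_neg hy, norm_smul, norm_unitInversion, Real.norm_eq_abs,
    abs_of_nonneg (sub_nonneg.2 hle)]
  set ρ := s * D.ratio o y
  have hpos : 0 < ‖y‖ := norm_pos_iff.2 hy
  have h1 : (2 * ‖y‖)⁻¹ ≤ ‖unitInversion y - ρ • D.center o‖ := by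
    have h2 := norm_sub_norm_le (unitInversion y) (ρ • D.center o)
    rw [norm_unitInversion, norm_smul, Real.norm_eq_abs, abs_of_nonneg hge] at h2
    have h3 : ρ * ‖D.center o‖ ≤ ‖D.center o‖ := mul_le_of_le_one_left (norm_nonneg _) hle
    have h4 : ‖D.center o‖ ≤ (2 * ‖y‖)⁻¹ := by
      rw [mul_inv, ← div_eq_mul_inv, le_div_iff₀ hpos]; linarith
    have h5 : ‖y‖⁻¹ = (2 * ‖y‖)⁻¹ + (2 * ‖y‖)⁻¹ := by field_simp; norm_num
    linarith
  have h6 : ‖unitInversion y - ρ • D.center o‖⁻¹ ≤ 2 * ‖y‖ := inv_le_of_inv_le₀ (by positivity) h1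
  exact (mul_le_of_le_one_left (inv_nonneg.2 (norm_nonneg _)) (by linarith)).trans h6

theorem continuousOn_flow : ContinuousOn (fun q : ℝ × E n => D.flow o q.1 q.2)
    (Set.Icc 0 1 ×ˢ ((Set.range D.p)ᶜ ∩ D.layer o)) := by
  rintro ⟨s, y⟩ ⟨hs, hyp, hyo⟩
  by_cases hy : y = 0
  · subst hy
    have h0 : D.flow o s 0 = 0 := if_pos rfl
    rw [ContinuousWithinAt]
    simp only [h0]
    have hlim : Filter.Tendsto (fun q : ℝ × E n => 2 * ‖q.2‖)
        (nhdsWithin (s, 0) (Set.Icc 0 1 ×ˢ ((Set.range D.p)ᶜ ∩ D.layer o))) (nhds 0) := by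
      have : Continuous fun q : ℝ × E n => 2 * ‖q.2‖ := by fun_prop
      simpa using (this.tendsto (s, (0 : E n))).mono_left nhdsWithin_le_nhds
    refine squeeze_zero_norm' ?_ hlim
    have hsmall : ∀ᶠ q : ℝ × E n in nhds (s, 0), ‖q.2‖ * ‖D.center o‖ < 1 / 2 := by
      have : Continuous fun q : ℝ × E n => ‖q.2‖ * ‖D.center o‖ := by fun_prop
      exact this.continuousAt.eventually_lt continuousAt_const (by simp)
    filter_upwards [nhdsWithin_le_nhds hsmall, self_mem_nhdsWithin] with q hq hq'
    exact norm_flow_le hq'.1 hq'.2.2 hq.le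
  · refine ContinuousAt.continuousWithinAt ?_
    have hev : ∀ᶠ q : ℝ × E n in nhds (s, y), q.2 ≠ 0 :=
      continuousAt_snd.eventually_ne hy
    have hr : ContinuousAt (fun q : ℝ × E n => q.1 * D.ratio o q.2) (s, y) :=
      continuousAt_fst.mul ((continuousAt_ratio hy).comp (f := Prod.snd) (x := (s, y)) continuousAt_snd)
    have hi : ContinuousAt (fun q : ℝ × E n => unitInversion q.2) (s, y) :=
      (continuousAt_unitInversion hy).comp (f := Prod.snd) (x := (s, y)) continuousAt_snd
    have hd : ContinuousAt
        (fun q : ℝ × E n => unitInversion q.2 - (q.1 * D.ratio o q.2) • D.center o) (s, y) :=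
      hi.sub (hr.smul continuousAt_const)
    have hf : ContinuousAt (fun q : ℝ × E n => (1 - q.1 * D.ratio o q.2) •
        unitInversion (unitInversion q.2 - (q.1 * D.ratio o q.2) • D.center o)) (s, y) :=
      (continuousAt_const.sub hr).smul
        (ContinuousAt.comp (g := unitInversion)
          (f := fun q : ℝ × E n => unitInversion q.2 - (q.1 * D.ratio o q.2) • D.center o)
          (x := (s, y))
          (continuousAt_unitInversion (sub_smul_center_ne_zero hs hy hyo hyp)) hd)
    refine hf.congr ?_
    filter_upwards [hev] with q hq
    simp [flow, hq]

variable (D)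

theorem p_not_mem_spheres (i : Fin k) : D.p i ∉ D.spheres := by
  rintro (h | ⟨j, hj⟩)
  · exact D.p_ne_zero i h
  · refine D.center_ne (some i) j ?_
    have : ‖D.p i‖ ^ 2 ≠ 0 := pow_ne_zero _ (norm_ne_zero_iff.2 (D.p_ne_zero i))
    change unitInversion (D.p i) 0 - D.h j = 0
    rw [unitInversion_apply_zero, hj, mul_comm (D.h j), inv_mul_cancel_left₀ this, sub_self]

theorem nonempty_homotopyEquiv_spheres :
    Nonempty (ContinuousMap.HomotopyEquiv D.spheres ((Set.range D.p)ᶜ : Set (E n))) := by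
  refine nonempty_homotopyEquiv_of_cells ?_ D.layer D.isClosed_layer
    (fun y _ => D.exists_mem_layer y) ?_ D.flow (fun o => continuousOn_flow)
    (fun o s hs y hy => flow_not_mem_range hs hy.2 hy.1) (fun o y _ => flow_zero)
    (fun o y _ => flow_one_mem) (fun o s y hy => flow_of_mem_spheres hy.1 hy.2 s)
  · rintro y hy ⟨i, rfl⟩
    exact D.p_not_mem_spheres i hy
  · rintro o o' h y ⟨⟨-, h1⟩, h2⟩
    exact D.layer_inter_layer_subset h ⟨h1, h2⟩

/-- The sphere through the origin with equation `y 0 = h i * ‖y‖ ^ 2` as an image of `S^n`. -/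
noncomputable def sphereMap (i : Fin k) (x : Sphere n) : E n :=
  (2 * D.h i)⁻¹ • ((Sphere.base n : E n) - x)

theorem sphereMap_base (i : Fin k) : D.sphereMap i (Sphere.base n) = 0 := by
  simp [sphereMap]

theorem inner_base (y : E n) : inner ℝ (Sphere.base n : E n) y = y 0 :=
  (EuclideanSpace.inner_single_left 0 1 y).trans (by simp)

theorem norm_base_sub_sq (x : Sphere n) :
    ‖(Sphere.base n : E n) - x‖ ^ 2 = 2 * ((Sphere.base n : E n) - x) 0 := by
  have h1 : ‖(Sphere.base n : E n)‖ = 1 := by simp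
  have h2 : ‖(x : E n)‖ = 1 := by simp
  have h3 : inner ℝ (Sphere.base n : E n) (x : E n) = (x : E n) 0 := inner_base _
  have h4 : (Sphere.base n : E n) 0 = 1 := by simp [Sphere.base]
  rw [norm_sub_sq_real, h1, h2, h3, PiLp.sub_apply, h4]
  ring

theorem sphereMap_apply_zero (i : Fin k) (x : Sphere n) :
    D.sphereMap i x 0 = D.h i * ‖D.sphereMap i x‖ ^ 2 := by
  have h := D.h_pos i
  rw [sphereMap, norm_smul, mul_pow, norm_base_sub_sq, PiLp.smul_apply, smul_eq_mul,
    Real.norm_eq_abs, sq_abs]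
  field_simp

/-- The map from the bouquet to the union of the spheres. -/
noncomputable def bouquetMap : Bouquet n k → D.spheres :=
  Quot.lift (fun t : Unit ⊕ (Fin k × Sphere n) => match t with
    | Sum.inl _ => ⟨0, Or.inl rfl⟩
    | Sum.inr (i, x) => ⟨D.sphereMap i x, Or.inr ⟨i, D.sphereMap_apply_zero i x⟩⟩) <| by
    rintro _ _ ⟨i, rfl, rfl⟩
    exact Subtype.ext (D.sphereMap_base i)

theorem continuous_bouquetMap : Continuous D.bouquetMap := by
  refine continuous_quot_lift _ ?_
  refine continuous_sum_dom.2 ⟨continuous_const, ?_⟩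
  refine Continuous.subtype_mk (f := fun t : Fin k × Sphere n => D.sphereMap t.1 t.2) ?_ _
  refine continuous_prod_of_discrete_left.2 fun i => ?_
  have h : Continuous fun x : Sphere n => (Sphere.base n : E n) - x := by fun_prop
  exact h.const_smul (2 * D.h i)⁻¹

theorem sphereMap_injective (i : Fin k) : Function.Injective (D.sphereMap i) := by
  intro x x' h
  have h1 : (2 * D.h i)⁻¹ ≠ 0 := inv_ne_zero (mul_pos two_pos (D.h_pos i)).ne'
  exact Subtype.ext (sub_right_injective (smul_right_injective _ h1 h))

/-- Away from the origin the spheres are disjoint, because the zeroth coordinate of the inversion of a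
point determines the sphere; the origin corresponds to the base points. -/
theorem bouquetMap_bijective : Function.Bijective D.bouquetMap := by
  have hzero : ∀ i x, D.sphereMap i x = 0 → (Quot.mk (bouquetRel n k) (Sum.inr (i, x))) =
      Quot.mk _ (Sum.inl ()) := by
    intro i x h
    have : x = Sphere.base n := D.sphereMap_injective i (h.trans (D.sphereMap_base i).symm)
    subst this
    exact Quot.sound ⟨i, rfl, rfl⟩
  constructor
  · rintro ⟨⟨⟩ | ⟨i, x⟩⟩ ⟨⟨⟩ | ⟨j, x'⟩⟩ h
    · rfl
    · exact (hzero j x' (congrArg Subtype.val h).symm).symm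
    · exact hzero i x (congrArg Subtype.val h)
    · have h' : D.sphereMap i x = D.sphereMap j x' := congrArg Subtype.val h
      by_cases h0 : D.sphereMap i x = 0
      · exact (hzero i x h0).trans (hzero j x' (h' ▸ h0)).symm
      · have h1 := D.sphereMap_apply_zero i x
        rw [h', D.sphereMap_apply_zero j x'] at h1
        have h2 : ‖D.sphereMap j x'‖ ^ 2 ≠ 0 :=
          pow_ne_zero _ (norm_ne_zero_iff.2 (h' ▸ h0))
        have hij : j = i := D.h_strictMono.injective (mul_right_cancel₀ h2 h1)
        subst hij
        rw [D.sphereMap_injective _ h']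
  · rintro ⟨y, hy⟩
    by_cases h0 : y = 0
    · exact ⟨Quot.mk _ (Sum.inl ()), Subtype.ext h0.symm⟩
    · obtain ⟨i, hi⟩ := hy.resolve_left h0
      have hpos := D.h_pos i
      have hbase : ‖(Sphere.base n : E n)‖ = 1 := by simp
      have hin : inner ℝ (Sphere.base n : E n) y = y 0 := inner_base y
      have hx : ‖(Sphere.base n : E n) - (2 * D.h i) • y‖ = 1 := by
        rw [← sq_eq_sq₀ (norm_nonneg _) zero_le_one, norm_sub_sq_real, hbase, norm_smul,
          inner_smul_right, hin, mul_pow, Real.norm_eq_abs, sq_abs, hi]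
        ring
      refine ⟨Quot.mk _ (Sum.inr (i, ⟨(Sphere.base n : E n) - (2 * D.h i) • y, by simpa using hx⟩)),
        Subtype.ext ?_⟩
      change (2 * D.h i)⁻¹ • ((Sphere.base n : E n) - ((Sphere.base n : E n) - (2 * D.h i) • y)) = y
      rw [sub_sub_cancel, inv_smul_smul₀ (by positivity)]

theorem nonempty_homeomorph_bouquet : Nonempty (Bouquet n k ≃ₜ D.spheres) := by
  have : CompactSpace (Bouquet n k) := Quot.compactSpace
  exact ⟨D.continuous_bouquetMap.homeoOfEquivCompactToT2
    (f := Equiv.ofBijective _ D.bouquetMap_bijective)⟩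

theorem nonempty_homotopyEquiv_bouquet :
    Nonempty (ContinuousMap.HomotopyEquiv ((Set.range D.p)ᶜ : Set (E n)) (Bouquet n k)) := by
  obtain ⟨e⟩ := D.nonempty_homotopyEquiv_spheres
  obtain ⟨f⟩ := D.nonempty_homeomorph_bouquet
  exact ⟨e.symm.trans f.symm.toHomotopyEquiv⟩

end SeparatedPoints

/-! ### The corner locus -/

theorem latticePoint_apply (a : Fin (n + 1) → ℤ) (i : Fin (n + 1)) : latticePoint a i = (a i : ℝ) :=
  rfl

theorem latticePoint_injective : Function.Injective (latticePoint (n := n)) := by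
  intro a b h
  funext i
  have := congrArg (fun x : E n => x i) h
  simpa [latticePoint_apply] using this

/-- The affine function `y ↦ a · y - v a`. -/
noncomputable def affineTerm (v : (Fin (n + 1) → ℤ) → ℝ) (a : Fin (n + 1) → ℤ) (y : E n) : ℝ :=
  inner ℝ (latticePoint a) y - v a

/-- The closed region on which the term of `a` attains the maximum. -/
def region (A : Finset (Fin (n + 1) → ℤ)) (v : (Fin (n + 1) → ℤ) → ℝ) (a : Fin (n + 1) → ℤ) :
    Set (E n) :=
  {y | ∀ b ∈ A, affineTerm v b y ≤ affineTerm v a y}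

/-- The open region on which the term of `a` is larger than all the others. -/
def openRegion (A : Finset (Fin (n + 1) → ℤ)) (v : (Fin (n + 1) → ℤ) → ℝ) (a : Fin (n + 1) → ℤ) :
    Set (E n) :=
  {y | ∀ b ∈ A, b ≠ a → affineTerm v b y < affineTerm v a y}

/-- The difference of the terms of `a` and `b`; `region` is where these are nonnegative. -/
noncomputable def gap (v : (Fin (n + 1) → ℤ) → ℝ) (a b : Fin (n + 1) → ℤ) (y : E n) : ℝ :=
  affineTerm v a y - affineTerm v b y

variable {A : Finset (Fin (n + 1) → ℤ)} {v : (Fin (n + 1) → ℤ) → ℝ} {a b : Fin (n + 1) → ℤ}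

theorem continuous_affineTerm : Continuous (affineTerm v a) := by
  unfold affineTerm; fun_prop

theorem continuous_gap : Continuous (gap v a b) := continuous_affineTerm.sub continuous_affineTerm

theorem openRegion_subset_region : openRegion A v a ⊆ region A v a := by
  intro y hy b hb
  by_cases h : b = a
  · rw [h]
  · exact (hy b hb h).le

theorem isClosed_region : IsClosed (region A v a) := by
  have : region A v a = ⋂ b ∈ A, {y | affineTerm v b y ≤ affineTerm v a y} := by
    ext y; simp [region]
  rw [this]
  exact isClosed_biInter fun b _ => isClosed_le continuous_affineTerm continuous_affineTerm

theorem isOpen_openRegion : IsOpen (openRegion A v a) := by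
  have : openRegion A v a = ⋂ b ∈ A, {y | b ≠ a → affineTerm v b y < affineTerm v a y} := by
    ext y; simp [openRegion]
  rw [this]
  refine isOpen_biInter_finset fun b _ => ?_
  by_cases h : b = a
  · simp [h]
  · simpa [h] using isOpen_lt continuous_affineTerm continuous_affineTerm

theorem exists_mem_region (hA : A.Nonempty) (y : E n) : ∃ a ∈ A, y ∈ region A v a :=
  A.exists_max_image (fun a => affineTerm v a y) hA

theorem eq_of_mem_region_of_mem_openRegion {y : E n} (hb : b ∈ A) (h : y ∈ region A v b)
    (ha : a ∈ A) (h' : y ∈ openRegion A v a) : a = b := by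
  by_contra hne
  exact absurd (h a ha) (not_le.2 (h' b hb (Ne.symm hne)))

theorem legendre_eq (hA : A.Nonempty) {y : E n} (ha : a ∈ A) (h : y ∈ region A v a) :
    legendre A hA v y = affineTerm v a y :=
  le_antisymm (Finset.sup'_le _ _ h) (Finset.le_sup' (fun a => affineTerm v a y) ha)

theorem affineTerm_le_legendre (hA : A.Nonempty) {y : E n} (ha : a ∈ A) :
    affineTerm v a y ≤ legendre A hA v y :=
  Finset.le_sup' (fun a => affineTerm v a y) ha

theorem mem_region_of_legendre_eq (hA : A.Nonempty) {y : E n}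
    (h : legendre A hA v y = affineTerm v a y) : y ∈ region A v a := fun _ hb =>
  (affineTerm_le_legendre hA hb).trans h.le

theorem hasFDerivAt_affineTerm (y : E n) :
    HasFDerivAt (affineTerm v a) (innerSL ℝ (latticePoint a)) y :=
  ((innerSL ℝ (latticePoint a)).hasFDerivAt).sub_const (v a)

/-- The maximum of finitely many affine functions with different linear parts is smooth exactly
where it is attained only once: at a point where it is attained by `a`, a derivative of the maximum
has to be the linear part of the term of `a`. -/
theorem mem_cornerLocus_iff (hA : A.Nonempty) {y : E n} : y ∈ cornerLocus (legendre A hA v) ↔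
    ∃ a ∈ A, ∃ b ∈ A, b ≠ a ∧ y ∈ region A v a ∧ y ∈ region A v b := by
  constructor
  · intro hy
    by_contra hcon
    push Not at hcon
    obtain ⟨a, ha, hya⟩ := exists_mem_region (v := v) hA y
    have hyo : y ∈ openRegion A v a := by
      intro b hb hba
      by_contra hlt
      exact hcon a ha b hb hba hya fun c hc => (hya c hc).trans (not_lt.1 hlt)
    refine hy ?_
    have hsmooth : ContDiff ℝ ∞ (affineTerm v a) :=
      (innerSL ℝ (latticePoint a)).contDiff.sub contDiff_const
    refine hsmooth.contDiffAt.congr_of_eventuallyEq ?_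
    filter_upwards [isOpen_openRegion.mem_nhds hyo] with z hz
    exact legendre_eq hA ha (openRegion_subset_region hz)
  · rintro ⟨a, ha, b, hb, hba, hya, hyb⟩ hsm
    have hd : DifferentiableAt ℝ (legendre A hA v) y := hsm.differentiableAt (by simp)
    have key : ∀ c ∈ A, y ∈ region A v c →
        fderiv ℝ (legendre A hA v) y = innerSL ℝ (latticePoint c) := by
      intro c hc hyc
      have hmin : IsLocalMin (fun z => legendre A hA v z - affineTerm v c z) y := by
        refine Filter.Eventually.of_forall fun z => ?_
        dsimp only
        rw [legendre_eq hA hc hyc, sub_self, sub_nonneg]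
        exact affineTerm_le_legendre hA hc
      exact sub_eq_zero.1 (hmin.hasFDerivAt_eq_zero (hd.hasFDerivAt.sub (hasFDerivAt_affineTerm y)))
    have h := (key a ha hya).symm.trans (key b hb hyb)
    exact hba (latticePoint_injective ((innerSL_inj (𝕜 := ℝ)).1 h)).symm

theorem gap_line (c y : E n) (t : ℝ) :
    gap v a b (y + t • (y - c)) = gap v a b y + t * (gap v a b y - gap v a b c) := by
  simp only [gap, affineTerm, inner_add_right, inner_smul_right, inner_sub_right]
  ring

theorem gap_add (y w : E n) :
    gap v a b (y + w) = gap v a b y + inner ℝ (latticePoint a - latticePoint b) w := by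
  simp only [gap, affineTerm, inner_add_right, inner_sub_left]
  ring

theorem gap_sub_gap (y z : E n) :
    gap v a b y - gap v a b z = inner ℝ (latticePoint a - latticePoint b) (y - z) := by
  simp only [gap, affineTerm, inner_sub_right, inner_sub_left]
  ring

section retraction

/-- The clipped ratio of the gaps at `y` and at the centre `c y`; it is `0` on the boundary of the
region of `a`. -/
noncomputable def regionRatio (A : Finset (Fin (n + 1) → ℤ)) (v : (Fin (n + 1) → ℤ) → ℝ)
    (a : Fin (n + 1) → ℤ) (c : E n → E n) (y : E n) : ℝ :=
  clippedRatio (fun b : {b // b ∈ A.erase a} => gap v a b y) (fun b => gap v a b (c y))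

/-- The movement of `y` straight away from the centre `c y`; at the time `s = 1` it arrives at the
boundary of the region of `a`. -/
noncomputable def regionFlow (A : Finset (Fin (n + 1) → ℤ)) (v : (Fin (n + 1) → ℤ) → ℝ)
    (a : Fin (n + 1) → ℤ) (c : E n → E n) (s : ℝ) (y : E n) : E n :=
  y + (s * (regionRatio A v a c y / (1 - regionRatio A v a c y))) • (y - c y)

variable {c : E n → E n} {y : E n}

theorem gap_pos (hc : ∀ y, c y ∈ openRegion A v a) (y : E n) (b : {b // b ∈ A.erase a}) :
    0 < gap v a b (c y) :=
  sub_pos.2 (hc y b (Finset.mem_of_mem_erase b.2) (Finset.ne_of_mem_erase b.2))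

theorem gap_nonneg (hy : y ∈ region A v a) (b : {b // b ∈ A.erase a}) : 0 ≤ gap v a b y :=
  sub_nonneg.2 (hy b (Finset.mem_of_mem_erase b.2))

theorem gap_self : gap v a a y = 0 := sub_self _

theorem regionRatio_lt_one (hc : ∀ y, c y ∈ openRegion A v a)
    (hb : ∃ b ∈ A, gap v a b y < gap v a b (c y)) : regionRatio A v a c y < 1 := by
  obtain ⟨b, hbA, hb⟩ := hb
  have hba : b ≠ a := by
    rintro rfl
    rw [gap_self, gap_self] at hb
    exact lt_irrefl _ hb
  exact clippedRatio_lt_one (gap_pos hc y) (i := ⟨b, Finset.mem_erase.2 ⟨hba, hbA⟩⟩) hb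

theorem regionRatio_nonneg (hc : ∀ y, c y ∈ openRegion A v a) (hy : y ∈ region A v a) :
    0 ≤ regionRatio A v a c y :=
  clippedRatio_nonneg (gap_pos hc y) (gap_nonneg hy)

theorem continuous_regionRatio (hcc : Continuous c) (hc : ∀ y, c y ∈ openRegion A v a) :
    Continuous (regionRatio A v a c) := by
  rw [← continuousOn_univ]
  unfold regionRatio
  exact continuousOn_clippedRatio (α := fun y (b : {b // b ∈ A.erase a}) => gap v a b y)
    (β := fun y b => gap v a b (c y)) (fun b => continuous_gap.continuousOn)
    (fun b => (continuous_gap.comp hcc).continuousOn) (gap_pos hc)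

theorem regionFlow_mem_region (hc : ∀ y, c y ∈ openRegion A v a) (hy : y ∈ region A v a)
    (hb : ∃ b ∈ A, gap v a b y < gap v a b (c y)) {s : ℝ} (hs : s ∈ Set.Icc (0 : ℝ) 1) :
    regionFlow A v a c s y ∈ region A v a := by
  intro b hbA
  rw [← sub_nonneg]
  change 0 ≤ gap v a b _
  by_cases hba : b = a
  · rw [hba, gap_self]
  have hbE : b ∈ A.erase a := Finset.mem_erase.2 ⟨hba, hbA⟩
  have h1 := regionRatio_lt_one hc hb
  have h0 := regionRatio_nonneg hc hy
  have h2 : regionRatio A v a c y * gap v a b (c y) ≤ gap v a b y :=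
    clippedRatio_mul_le (gap_pos hc y) ⟨b, hbE⟩
  have h3 := gap_pos hc y ⟨b, hbE⟩
  have h4 := gap_nonneg hy ⟨b, hbE⟩
  dsimp only at h3 h4
  rw [regionFlow, gap_line]
  set m := regionRatio A v a c y
  have h5 : 0 < 1 - m := sub_pos.2 h1
  have h6 : 0 ≤ s * (m / (1 - m)) := mul_nonneg hs.1 (div_nonneg h0 h5.le)
  have h7 : s * (m / (1 - m)) ≤ m / (1 - m) := mul_le_of_le_one_left (div_nonneg h0 h5.le) hs.2
  have h8 : gap v a b y + m / (1 - m) * (gap v a b y - gap v a b (c y)) =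
      (gap v a b y - m * gap v a b (c y)) / (1 - m) := by field_simp; ring
  have h9 : 0 ≤ (gap v a b y - m * gap v a b (c y)) / (1 - m) := div_nonneg (by linarith) h5.le
  rcases le_or_gt 0 (gap v a b y - gap v a b (c y)) with h | h
  · have := mul_nonneg h6 h
    linarith
  · have := mul_le_mul_of_nonpos_right h7 h.le
    linarith

theorem regionFlow_one_mem_cornerLocus (hA : A.Nonempty) (ha : a ∈ A)
    (hc : ∀ y, c y ∈ openRegion A v a) (hy : y ∈ region A v a)
    (hb : ∃ b ∈ A, gap v a b y < gap v a b (c y)) :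
    regionFlow A v a c 1 y ∈ cornerLocus (legendre A hA v) := by
  have h1 := regionRatio_lt_one hc hb
  have hmem := regionFlow_mem_region hc hy hb (s := 1) ⟨zero_le_one, le_rfl⟩
  obtain ⟨⟨b, hbE⟩, hbm⟩ := (clippedRatio_eq_one_or (gap_pos hc y)).resolve_left h1.ne
  change regionRatio A v a c y * _ = _ at hbm
  have h5 : 0 < 1 - regionRatio A v a c y := sub_pos.2 h1
  have hzero : gap v a b (regionFlow A v a c 1 y) = 0 := by
    rw [regionFlow, gap_line]
    set m := regionRatio A v a c y
    dsimp only at hbm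
    rw [← hbm]
    field_simp
    ring
  refine (mem_cornerLocus_iff hA).2 ⟨a, ha, b, Finset.mem_of_mem_erase hbE,
    Finset.ne_of_mem_erase hbE, hmem, fun d hd => (hmem d hd).trans (sub_eq_zero.1 hzero).le⟩

theorem regionFlow_of_mem_cornerLocus (hA : A.Nonempty) (ha : a ∈ A)
    (hc : ∀ y, c y ∈ openRegion A v a) (hy : y ∈ region A v a)
    (hyP : y ∈ cornerLocus (legendre A hA v)) (s : ℝ) : regionFlow A v a c s y = y := by
  obtain ⟨b, hb, b', hb', hne, h1, h2⟩ := (mem_cornerLocus_iff hA).1 hyP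
  obtain ⟨d, hd, hda, hyd⟩ : ∃ d ∈ A, d ≠ a ∧ y ∈ region A v d := by
    by_cases h : b = a
    · exact ⟨b', hb', h ▸ hne, h2⟩
    · exact ⟨b, hb, h, h1⟩
  have hzero : regionRatio A v a c y = 0 :=
    clippedRatio_eq_zero (gap_pos hc y) (gap_nonneg hy) (i := ⟨d, Finset.mem_erase.2 ⟨hda, hd⟩⟩)
      (sub_eq_zero.2 (le_antisymm (hyd a ha) (hy d hd)))
  simp [regionFlow, hzero]

/-- A region whose lattice point `a` lies on the boundary of `Δ` is unbounded, in the direction of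
a functional `w` that is maximal on `Δ` at `a`. Its points can be moved to its boundary away from
centres that recede in the direction of `w`. -/
theorem exists_center_of_not_mem_interior
    (hint : (interior (newtonPolyhedron A)).Nonempty)
    (hna : latticePoint a ∉ interior (newtonPolyhedron A)) (hne : (openRegion A v a).Nonempty) :
    ∃ c : E n → E n, Continuous c ∧ (∀ y, c y ∈ openRegion A v a) ∧
      ∀ y, ∃ b ∈ A, gap v a b y < gap v a b (c y) := by
  have hconv : Convex ℝ (newtonPolyhedron A) := convex_convexHull ℝ _
  obtain ⟨f, hf⟩ := geometric_hahn_banach_open_point hconv.interior isOpen_interior hna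
  obtain ⟨w, rfl⟩ := (InnerProductSpace.toDual ℝ (E n)).surjective f
  simp only [InnerProductSpace.toDual_apply_apply] at hf
  have hle : ∀ z ∈ newtonPolyhedron A, inner ℝ w z ≤ inner ℝ w (latticePoint a) := by
    intro z hz
    have hz' : z ∈ closure (interior (newtonPolyhedron A)) := by
      rw [hconv.closure_interior_eq_closure_of_nonempty_interior hint]
      exact subset_closure hz
    exact closure_minimal (t := {z | inner ℝ w z ≤ inner ℝ w (latticePoint a)})
      (fun z hz => (hf z hz).le) (isClosed_le (by fun_prop) continuous_const) hz'
  have hleA : ∀ b ∈ A, inner ℝ w (latticePoint b) ≤ inner ℝ w (latticePoint a) := fun b hb =>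
    hle _ (subset_convexHull ℝ _ (Set.mem_image_of_mem _ hb))
  obtain ⟨b, hb, hlt⟩ : ∃ b ∈ A, inner ℝ w (latticePoint b) < inner ℝ w (latticePoint a) := by
    by_contra hcon
    push Not at hcon
    obtain ⟨z, hz⟩ := hint
    have hge : newtonPolyhedron A ⊆ {z | inner ℝ w (latticePoint a) ≤ inner ℝ w z} := by
      refine convexHull_min ?_ (convex_halfSpace_ge (innerₗ (E n) w).isLinear _)
      rintro _ ⟨b, hb, rfl⟩
      exact hcon b hb
    exact absurd (hge (interior_subset hz)) (not_le.2 (hf z hz))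
  obtain ⟨q, hq⟩ := hne
  set u := latticePoint a - latticePoint b with hu
  have huw : 0 < inner ℝ u w := by
    rw [hu, inner_sub_left, real_inner_comm, real_inner_comm w (latticePoint b)]
    linarith
  refine ⟨fun y => q + ((|inner ℝ u (y - q)| + 1) / inner ℝ u w) • w, ?_, ?_, ?_⟩
  · fun_prop
  · intro y d hd hda
    rw [← sub_pos]
    change 0 < gap v a d _
    have hdw : 0 ≤ inner ℝ (latticePoint a - latticePoint d) w := by
      rw [real_inner_comm, inner_sub_right]
      exact sub_nonneg.2 (hleA d hd)
    rw [gap_add, inner_smul_right]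
    exact add_pos_of_pos_of_nonneg (sub_pos.2 (hq d hd hda)) (mul_nonneg (by positivity) hdw)
  · intro y
    refine ⟨b, hb, ?_⟩
    rw [← sub_neg, gap_sub_gap, ← hu, ← sub_sub, inner_sub_right, inner_smul_right,
      div_mul_cancel₀ _ huw.ne']
    linarith [le_abs_self (inner ℝ u (y - q))]

/-- The region of an interior lattice point `a` of `Δ` is bounded: on each ray that starts in its
interior one of the gaps decreases. -/
theorem exists_gap_lt_of_mem_interior (hia : latticePoint a ∈ interior (newtonPolyhedron A))
    {y q : E n} (hyq : y ≠ q) : ∃ b ∈ A, gap v a b y < gap v a b q := by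
  by_contra hcon
  push Not at hcon
  have hge : newtonPolyhedron A ⊆
      {z | inner ℝ (y - q) z ≤ inner ℝ (y - q) (latticePoint a)} := by
    refine convexHull_min ?_ (convex_halfSpace_le (innerₗ (E n) (y - q)).isLinear _)
    rintro _ ⟨b, hb, rfl⟩
    have h := sub_nonneg.2 (hcon b hb)
    rw [gap_sub_gap, real_inner_comm, inner_sub_right] at h
    exact sub_nonneg.1 h
  have hcont : Continuous fun t : ℝ => latticePoint a + t • (y - q) := by fun_prop
  have hev : ∀ᶠ t in nhds (0 : ℝ), latticePoint a + t • (y - q) ∈ interior (newtonPolyhedron A) :=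
    hcont.continuousAt.eventually_mem (by simpa using isOpen_interior.mem_nhds hia)
  obtain ⟨t, ht, ht0⟩ := ((hev.filter_mono nhdsWithin_le_nhds).and
    (self_mem_nhdsWithin (s := Set.Ioi (0 : ℝ)))).exists
  have h := hge (interior_subset ht)
  simp only [Set.mem_ofPred_eq, inner_add_right, inner_smul_right, real_inner_self_eq_norm_sq] at h
  have h2 : 0 < t * ‖y - q‖ ^ 2 :=
    mul_pos ht0 (pow_pos (norm_pos_iff.2 (sub_ne_zero.2 hyq)) 2)
  linarith

/-- The complement of one point in the interior of each bounded region retracts onto the corner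
locus. -/
theorem nonempty_homotopyEquiv_cornerLocus (hA : A.Nonempty)
    (hint : (interior (newtonPolyhedron A)).Nonempty)
    (hne : ∀ a ∈ A, (openRegion A v a).Nonempty)
    (hI : interiorLatticePoints (newtonPolyhedron A) ⊆ A)
    (p : interiorLatticePoints (newtonPolyhedron A) → E n)
    (hp : ∀ a : interiorLatticePoints (newtonPolyhedron A), p a ∈ openRegion A v a) :
    Nonempty (ContinuousMap.HomotopyEquiv (cornerLocus (legendre A hA v))
      ((Set.range p)ᶜ : Set (E n))) := by
  -- The last condition says that a point that moves away from the centre never meets a puncture.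
  have hcenter : ∀ a : {a // a ∈ A}, ∃ c : E n → E n, Continuous c ∧
      (∀ y, c y ∈ openRegion A v a) ∧
      (∀ y ∈ (Set.range p)ᶜ, ∃ b ∈ A, gap v a b y < gap v a b (c y)) ∧
      (∀ y ∈ (Set.range p)ᶜ, ∀ t : ℝ, 0 ≤ t → y + t • (y - c y) ∈ region A v a →
        y + t • (y - c y) ∈ (Set.range p)ᶜ) := by
    rintro ⟨a, ha⟩
    have hpa : ∀ i, p i ∈ region A v a → (i : Fin (n + 1) → ℤ) = a := fun i hi =>
      eq_of_mem_region_of_mem_openRegion ha hi (hI i.2) (hp i)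
    by_cases hia : a ∈ interiorLatticePoints (newtonPolyhedron A)
    · refine ⟨fun _ => p ⟨a, hia⟩, continuous_const, fun _ => hp ⟨a, hia⟩, fun y hy => ?_, ?_⟩
      · exact exists_gap_lt_of_mem_interior hia fun h => hy ⟨⟨a, hia⟩, h.symm⟩
      · rintro y hy t ht hmem ⟨i, hi⟩
        have hia' : i = ⟨a, hia⟩ := Subtype.ext (hpa i (hi ▸ hmem))
        have h1 : (1 + t) • (y - p ⟨a, hia⟩) = 0 := by
          rw [add_smul, one_smul, sub_add_eq_add_sub, ← hi, hia', sub_self]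
        rcases smul_eq_zero.1 h1 with h | h
        · linarith
        · exact hy ⟨⟨a, hia⟩, (sub_eq_zero.1 h).symm⟩
    · obtain ⟨c, hcc, hc, hb⟩ := exists_center_of_not_mem_interior hint hia (hne a ha)
      refine ⟨c, hcc, hc, fun y _ => hb y, ?_⟩
      rintro y hy t ht hmem ⟨i, hi⟩
      exact hia (hpa i (hi ▸ hmem) ▸ i.2)
  choose c hcc hc hb hstay using hcenter
  refine nonempty_homotopyEquiv_of_cells ?_ (fun a : {a // a ∈ A} => region A v a)
    (fun a => isClosed_region) ?_ ?_ (fun a => regionFlow A v a (c a)) ?_ ?_ ?_ ?_ ?_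
  · rintro y hy ⟨i, rfl⟩
    obtain ⟨a, ha, b, hb, hne, h1, h2⟩ := (mem_cornerLocus_iff hA).1 hy
    rw [← eq_of_mem_region_of_mem_openRegion ha h1 (hI i.2) (hp i),
      ← eq_of_mem_region_of_mem_openRegion hb h2 (hI i.2) (hp i)] at hne
    exact hne rfl
  · intro y _
    obtain ⟨a, ha, h⟩ := exists_mem_region (v := v) hA y
    exact ⟨⟨a, ha⟩, h⟩
  · rintro a b hab y ⟨⟨-, h1⟩, h2⟩
    exact (mem_cornerLocus_iff hA).2 ⟨a, a.2, b, b.2, fun h => hab (Subtype.ext h.symm), h1, h2⟩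
  · intro a
    have hr := continuous_regionRatio (hcc a) (hc a)
    have hq : ContinuousOn (fun q : ℝ × E n =>
        regionRatio A v a (c a) q.2 / (1 - regionRatio A v a (c a) q.2))
        (Set.Icc 0 1 ×ˢ ((Set.range p)ᶜ ∩ region A v a)) := by
      refine ContinuousOn.div (hr.comp continuous_snd).continuousOn
        (continuous_const.sub (hr.comp continuous_snd)).continuousOn fun q hq => ?_
      exact (sub_pos.2 (regionRatio_lt_one (hc a) (hb a q.2 hq.2.1))).ne'
    exact continuousOn_snd.add ((continuousOn_fst.mul hq).smul
      (continuous_snd.sub ((hcc a).comp continuous_snd)).continuousOn)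
  · intro a s hs y hy
    refine hstay a y hy.1 _ ?_ (regionFlow_mem_region (hc a) hy.2 (hb a y hy.1) hs)
    exact mul_nonneg hs.1 (div_nonneg (regionRatio_nonneg (hc a) hy.2)
      (sub_pos.2 (regionRatio_lt_one (hc a) (hb a y hy.1))).le)
  · intro a y _
    simp [regionFlow]
  · intro a y hy
    exact regionFlow_one_mem_cornerLocus hA a.2 (hc a) hy.2 (hb a y hy.1)
  · intro a s y hy
    exact regionFlow_of_mem_cornerLocus hA a.2 (hc a) hy.2 hy.1 s

end retraction

/-! ### Unimodular simplices -/

/-- The simplex spanned by the origin and the standard basis vectors. -/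
def cornerSimplex (N : ℕ) : Set (Fin N → ℝ) := {t | (∀ j, 0 ≤ t j) ∧ ∑ j, t j ≤ 1}

/-- The lower triangular matrix that takes a vector to its partial sums. -/
def partialSumMatrix (N : ℕ) : Matrix (Fin N) (Fin N) ℝ := fun i j => if j ≤ i then 1 else 0

theorem det_partialSumMatrix (N : ℕ) : (partialSumMatrix N).det = 1 := by
  rw [Matrix.det_of_isLowerTriangular]
  · simp [partialSumMatrix]
  · intro i j hij
    exact if_neg (not_le.2 hij)

/-- The point `y` is the vector of partial sums of its increments; these are continued by the value
`1` beyond the last coordinate, so that they stay nonnegative. -/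
theorem exists_partialSum_eq {N : ℕ} {y : Fin N → ℝ} (hy : Monotone y) (h0 : ∀ i, 0 ≤ y i)
    (h1 : ∀ i, y i ≤ 1) : ∃ t ∈ cornerSimplex N, (partialSumMatrix N).mulVec t = y := by
  let Y : ℕ → ℝ := fun k => if k = 0 then 0 else if h : k - 1 < N then y ⟨k - 1, h⟩ else 1
  have hY : ∀ i : Fin N, Y (i + 1) = y i := fun i => by simp [Y]
  have hYm : ∀ k, Y k ≤ Y (k + 1) := by
    intro k
    rcases k with _ | k
    · by_cases h : 0 < N
      · simp only [Y, zero_add, if_pos rfl, one_ne_zero, if_false, Nat.sub_self, dif_pos h]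
        exact h0 _
      · simp [Y, h]
    · by_cases h : k + 1 < N
      · have h' : k < N := by omega
        simp only [Y, Nat.add_sub_cancel, Nat.succ_ne_zero, if_false, dif_pos h, dif_pos h']
        exact hy (Fin.mk_le_mk.2 (Nat.le_succ k))
      · by_cases h' : k < N
        · simp only [Y, Nat.add_sub_cancel, Nat.succ_ne_zero, if_false, dif_neg h, dif_pos h']
          exact h1 _
        · simp [Y, h, h']
  have hYN : Y N ≤ 1 := by
    rcases N with _ | N
    · simp [Y]
    · exact (hY (Fin.last N)).trans_le (h1 _)
  refine ⟨fun j => Y (j + 1) - Y j, ⟨fun j => sub_nonneg.2 (hYm j), ?_⟩, ?_⟩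
  · rw [Fin.sum_univ_eq_sum_range (fun j => Y (j + 1) - Y j), Finset.sum_range_sub]
    simpa [Y] using hYN
  · funext i
    have h2 : ∀ j : Fin N, partialSumMatrix N i j * (Y (j + 1) - Y j) =
        (fun k : ℕ => if k ≤ (i : ℕ) then Y (k + 1) - Y k else 0) j := by
      intro j
      by_cases h : j ≤ i
      · simp [partialSumMatrix, h]
      · simp [partialSumMatrix, h]
    rw [Matrix.mulVec, dotProduct, Finset.sum_congr rfl fun j _ => h2 j,
      Fin.sum_univ_eq_sum_range (fun k : ℕ => if k ≤ (i : ℕ) then Y (k + 1) - Y k else 0),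
      ← Finset.sum_filter]
    have h3 : (Finset.range N).filter (fun k => k ≤ (i : ℕ)) = Finset.range (i + 1) := by
      ext k
      simp only [Finset.mem_filter, Finset.mem_range]
      omega
    rw [h3, Finset.sum_range_sub, hY]
    simp [Y]

/-- The cube is covered by the `N !` simplices that consist of the points whose coordinates have a
given order, and each of them is a unimodular image of the standard simplex. -/
theorem one_le_factorial_mul_volume (N : ℕ) :
    1 ≤ (N.factorial : ENNReal) * MeasureTheory.volume (cornerSimplex N) := by
  let M : Equiv.Perm (Fin N) → Matrix (Fin N) (Fin N) ℝ := fun σ =>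
    (partialSumMatrix N).submatrix σ id
  have hM : ∀ σ, |(M σ).det| = 1 := by
    intro σ
    rw [Matrix.det_permute, det_partialSumMatrix, mul_one]
    rcases Int.units_eq_one_or (Equiv.Perm.sign σ) with h | h <;> simp [h]
  have hcov : Set.Icc (0 : Fin N → ℝ) 1 ⊆
      ⋃ σ : Equiv.Perm (Fin N), Matrix.toLin' (M σ) '' cornerSimplex N := by
    intro x hx
    obtain ⟨t, ht, hxt⟩ := exists_partialSum_eq (y := x ∘ Tuple.sort x) (Tuple.monotone_sort x)
      (fun i => hx.1 _) (fun i => hx.2 _)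
    refine Set.mem_iUnion.2 ⟨(Tuple.sort x)⁻¹, t, ht, ?_⟩
    funext i
    have := congrFun hxt ((Tuple.sort x)⁻¹ i)
    simpa [M, Matrix.toLin'_apply, Matrix.mulVec] using this
  calc (1 : ENNReal) = MeasureTheory.volume (Set.Icc (0 : Fin N → ℝ) 1) := by
        simp [Real.volume_Icc_pi]
    _ ≤ MeasureTheory.volume (⋃ σ : Equiv.Perm (Fin N), Matrix.toLin' (M σ) '' cornerSimplex N) :=
        MeasureTheory.measure_mono hcov
    _ ≤ ∑ σ : Equiv.Perm (Fin N),
          MeasureTheory.volume (Matrix.toLin' (M σ) '' cornerSimplex N) :=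
        MeasureTheory.measure_iUnion_fintype_le _ _
    _ = ∑ _σ : Equiv.Perm (Fin N), MeasureTheory.volume (cornerSimplex N) := by
        refine Finset.sum_congr rfl fun σ _ => ?_
        rw [MeasureTheory.Measure.addHaar_image_linearMap, LinearMap.det_toLin', hM]
        simp
    _ = (N.factorial : ENNReal) * MeasureTheory.volume (cornerSimplex N) := by
        simp [Fintype.card_perm]

theorem eq_vertex_of_one_le_coord {ι V : Type*} [Fintype ι] [AddCommGroup V] [Module ℝ V]
    (b : AffineBasis ι ℝ V) {z : V} (hz : z ∈ convexHull ℝ (Set.range b)) {i : ι}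
    (hi : 1 ≤ b.coord i z) : z = b i := by
  rw [b.convexHull_eq_nonneg_coord] at hz
  have hsum := b.sum_coord_apply_eq_one z
  have hzero : ∀ j, j ≠ i → b.coord j z = 0 := by
    intro j hj
    have h := Finset.add_le_sum (fun j _ => hz j) (Finset.mem_univ i) (Finset.mem_univ j) hj.symm
    have h0 : 0 ≤ b.coord j z := hz j
    linarith
  have h1 : b.coord i z = 1 := by
    rw [← hsum]
    exact (Finset.sum_eq_single i (fun j _ hj => hzero j hj) (by simp)).symm
  rw [← b.linear_combination_coord_eq_self z,
    Finset.sum_eq_single i (fun j _ hj => by rw [hzero j hj, zero_smul]) (by simp), h1, one_smul]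

/-- The edge vectors from the zeroth vertex, as the columns of an integral matrix. -/
def edgeMatrix (a : Fin (n + 2) → Fin (n + 1) → ℤ) : Matrix (Fin (n + 1)) (Fin (n + 1)) ℤ :=
  fun i j => a j.succ i - a 0 i

/-- The barycentric coordinates of `x` with respect to the vertices other than the zeroth are its
coordinates with respect to the edges from the zeroth vertex. -/
theorem edgeMatrix_mulVec_coord (a : Fin (n + 2) → Fin (n + 1) → ℤ)
    (b : AffineBasis (Fin (n + 2)) ℝ (E n)) (hb : ∀ i, b i = latticePoint (a i)) (x : E n) :
    ((edgeMatrix a).map (Int.cast : ℤ → ℝ)).mulVec (fun j => b.coord j.succ x) =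
      fun i => x i - a 0 i := by
  funext i
  have h1 := b.linear_combination_coord_eq_self x
  have h2 := b.sum_coord_apply_eq_one x
  have h3 : ∑ j, b.coord j x * (a j i : ℝ) = x i := by
    conv_rhs => rw [← h1]
    simp [hb, latticePoint_apply]
  rw [Fin.sum_univ_succ] at h2 h3
  simp only [Matrix.mulVec, dotProduct, Matrix.map_apply, edgeMatrix, Int.cast_sub, sub_mul,
    Finset.sum_sub_distrib]
  rw [← Finset.mul_sum]
  have h4 : ∑ j : Fin (n + 1), (a j.succ i : ℝ) * b.coord j.succ x =
      ∑ j : Fin (n + 1), b.coord j.succ x * (a j.succ i : ℝ) :=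
    Finset.sum_congr rfl fun j _ => mul_comm _ _
  rw [h4]
  linear_combination h3 - (a 0 i : ℝ) * h2

theorem volume_convexHull (a : Fin (n + 2) → Fin (n + 1) → ℤ)
    (b : AffineBasis (Fin (n + 2)) ℝ (E n)) (hb : ∀ i, b i = latticePoint (a i)) :
    MeasureTheory.volume (convexHull ℝ (Set.range b)) =
      ENNReal.ofReal |((edgeMatrix a).det : ℝ)| * MeasureTheory.volume (cornerSimplex (n + 1)) := by
  set B : Matrix (Fin (n + 1)) (Fin (n + 1)) ℝ := (edgeMatrix a).map (Int.cast : ℤ → ℝ) with hB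
  have hdet : ((edgeMatrix a).det : ℝ) = B.det := by
    rw [hB]; exact Int.cast_det _
  have himage : convexHull ℝ (Set.range b) =
      (fun z : Fin (n + 1) → ℝ => latticePoint (a 0) + WithLp.toLp 2 z) ''
        (Matrix.toLin' B '' cornerSimplex (n + 1)) := by
    rw [b.convexHull_eq_nonneg_coord]
    ext x
    constructor
    · intro hx
      refine ⟨_, ⟨fun j => b.coord j.succ x, ⟨fun j => hx _, ?_⟩, rfl⟩, ?_⟩
      · have h2 := b.sum_coord_apply_eq_one x
        rw [Fin.sum_univ_succ] at h2
        linarith [hx 0]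
      · rw [Matrix.toLin'_apply, edgeMatrix_mulVec_coord a b hb]
        ext i
        simp [latticePoint_apply]
    · rintro ⟨_, ⟨t, ht, rfl⟩, rfl⟩
      rw [← b.convexHull_eq_nonneg_coord]
      have hx : latticePoint (a 0) + WithLp.toLp 2 (Matrix.toLin' B t) =
          ∑ j : Fin (n + 2), (Fin.cons (1 - ∑ j, t j) t : Fin (n + 2) → ℝ) j • b j := by
        ext i
        rw [Fin.sum_univ_succ]
        simp only [Fin.cons_zero, Fin.cons_succ, hb, PiLp.add_apply, PiLp.smul_apply,
          latticePoint_apply, Matrix.toLin'_apply, smul_eq_mul, hB, Matrix.mulVec, dotProduct,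
          Matrix.map_apply, edgeMatrix, Int.cast_sub, sub_mul, Finset.sum_sub_distrib,
          WithLp.ofLp_sum, Finset.sum_apply, WithLp.ofLp_smul, Pi.smul_apply, one_mul]
        rw [← Finset.mul_sum]
        have h4 : ∑ j : Fin (n + 1), (a j.succ i : ℝ) * t j =
            ∑ j : Fin (n + 1), t j * (a j.succ i : ℝ) :=
          Finset.sum_congr rfl fun j _ => mul_comm _ _
        rw [h4]
        ring
      dsimp only
      rw [hx]
      refine (convex_convexHull ℝ _).sum_mem ?_ ?_
        fun j _ => subset_convexHull ℝ _ (Set.mem_range_self j)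
      · intro j _
        refine Fin.cases ?_ (fun j => ?_) j
        · simpa using ht.2
        · simpa using ht.1 j
      · rw [Fin.sum_univ_succ]
        simp
  have hpre : ∀ s : Set (Fin (n + 1) → ℝ),
      (fun z : Fin (n + 1) → ℝ => latticePoint (a 0) + WithLp.toLp 2 z) '' s =
        (fun x => -latticePoint (a 0) + x) ⁻¹'
          ((MeasurableEquiv.toLp 2 (Fin (n + 1) → ℝ)).symm ⁻¹' s) := by
    intro s
    ext x
    constructor
    · rintro ⟨z, hz, rfl⟩
      simpa using hz
    · intro hx
      exact ⟨_, hx, by simp⟩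
  rw [himage, hpre, MeasureTheory.measure_preimage_add,
    (EuclideanSpace.volume_preserving_symm_measurableEquiv_toLp _).measure_preimage_equiv,
    MeasureTheory.Measure.addHaar_image_linearMap, LinearMap.det_toLin', hdet]

/-- The edges from a vertex of a lattice simplex of volume `1 / (n + 1)!` form a basis of the
lattice. -/
theorem isUnit_det_edgeMatrix (a : Fin (n + 2) → Fin (n + 1) → ℤ)
    (b : AffineBasis (Fin (n + 2)) ℝ (E n)) (hb : ∀ i, b i = latticePoint (a i))
    (hvol : MeasureTheory.volume (convexHull ℝ (Set.range b)) =
      ENNReal.ofReal (1 / ((n + 1).factorial : ℝ))) : IsUnit (edgeMatrix a).det := by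
  rw [volume_convexHull a b hb] at hvol
  have h1 := one_le_factorial_mul_volume (n + 1)
  have hfac : (0 : ℝ) < ((n + 1).factorial : ℝ) := by positivity
  have h2 : ENNReal.ofReal |((edgeMatrix a).det : ℝ)| ≤ 1 := by
    calc ENNReal.ofReal |((edgeMatrix a).det : ℝ)|
        ≤ ENNReal.ofReal |((edgeMatrix a).det : ℝ)| *
          (((n + 1).factorial : ENNReal) * MeasureTheory.volume (cornerSimplex (n + 1))) :=
          le_mul_of_one_le_right zero_le h1
      _ = ((n + 1).factorial : ENNReal) * ENNReal.ofReal (1 / ((n + 1).factorial : ℝ)) := by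
          rw [← hvol]; ring
      _ = 1 := by
          rw [← ENNReal.ofReal_natCast, ← ENNReal.ofReal_mul hfac.le, mul_one_div_cancel hfac.ne',
            ENNReal.ofReal_one]
  have h3 : |(edgeMatrix a).det| ≤ 1 := by
    rw [ENNReal.ofReal_le_one] at h2
    exact_mod_cast h2
  have h4 : (edgeMatrix a).det ≠ 0 := by
    intro h0
    rw [h0, Int.cast_zero, abs_zero, ENNReal.ofReal_zero, zero_mul, eq_comm,
      ENNReal.ofReal_eq_zero] at hvol
    exact absurd hvol (not_le.2 (by positivity))
  rw [Int.isUnit_iff_abs_eq]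
  exact le_antisymm h3 (Int.one_le_abs h4)

/-- The only lattice points of a unimodular lattice simplex are its vertices. -/
theorem exists_eq_vertex (a : Fin (n + 2) → Fin (n + 1) → ℤ)
    (b : AffineBasis (Fin (n + 2)) ℝ (E n)) (hb : ∀ i, b i = latticePoint (a i))
    (hvol : MeasureTheory.volume (convexHull ℝ (Set.range b)) =
      ENNReal.ofReal (1 / ((n + 1).factorial : ℝ)))
    {x : Fin (n + 1) → ℤ} (hx : latticePoint x ∈ convexHull ℝ (Set.range b)) :
    ∃ i, x = a i := by
  have hu := isUnit_det_edgeMatrix a b hb hvol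
  have hint : ∃ m : Fin (n + 1) → ℤ, ∀ j, b.coord j.succ (latticePoint x) = m j := by
    refine ⟨(edgeMatrix a)⁻¹.mulVec fun i => x i - a 0 i, fun j => ?_⟩
    have h1 := edgeMatrix_mulVec_coord a b hb (latticePoint x)
    have h2 : (((edgeMatrix a)⁻¹).map (Int.cast : ℤ → ℝ)) *
        ((edgeMatrix a).map (Int.cast : ℤ → ℝ)) = 1 := by
      have h := Matrix.map_mul (L := (edgeMatrix a)⁻¹) (M := edgeMatrix a) (f := Int.castRingHom ℝ)
      rw [Matrix.nonsing_inv_mul _ hu] at h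
      exact h.symm.trans (Matrix.map_one _ (map_zero _) (map_one _))
    have h3 := congrArg (((edgeMatrix a)⁻¹).map (Int.cast : ℤ → ℝ)).mulVec h1
    rw [Matrix.mulVec_mulVec, h2, Matrix.one_mulVec] at h3
    rw [congrFun h3 j]
    simp [Matrix.mulVec, dotProduct, latticePoint_apply]
  obtain ⟨m, hm⟩ := hint
  have hnn : ∀ j, 0 ≤ b.coord j (latticePoint x) := by
    rw [b.convexHull_eq_nonneg_coord] at hx; exact hx
  have hsum := b.sum_coord_apply_eq_one (latticePoint x)
  obtain ⟨i, hi⟩ : ∃ i, 1 ≤ b.coord i (latticePoint x) := by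
    by_cases h : ∃ j, m j ≠ 0
    · obtain ⟨j, hj⟩ := h
      have h0 : (0 : ℝ) ≤ m j := hm j ▸ hnn j.succ
      have h0' : 0 ≤ m j := by exact_mod_cast h0
      refine ⟨j.succ, ?_⟩
      rw [hm]
      exact_mod_cast (lt_of_le_of_ne h0' (Ne.symm hj) : 0 < m j)
    · push Not at h
      refine ⟨0, ?_⟩
      rw [Fin.sum_univ_succ] at hsum
      simp only [hm, h, Int.cast_zero, Finset.sum_const_zero, add_zero] at hsum
      exact hsum.ge
  exact ⟨i, latticePoint_injective ((eq_vertex_of_one_le_coord b hx hi).trans (hb i))⟩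

/-- A lattice point of a unimodular simplex is a vertex, and there is a linear functional that is
larger at this vertex than at the other ones. -/
theorem IsUnimodularSimplex.exists_direction {V : Set (Fin (n + 1) → ℤ)}
    (h : IsUnimodularSimplex (convexHull ℝ (latticePoint '' V))) {x : Fin (n + 1) → ℤ}
    (hx : latticePoint x ∈ convexHull ℝ (latticePoint '' V)) :
    x ∈ V ∧ ∃ d : E n, ∀ b ∈ V, b ≠ x → 0 < inner ℝ (latticePoint x - latticePoint b) d := by
  obtain ⟨⟨s, hs⟩, hvol⟩ := h
  have htop : affineSpan ℝ (Set.range s.points) = ⊤ := by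
    rw [s.independent.affineSpan_eq_top_iff_card_eq_finrank_add_one]
    simp
  let B : AffineBasis (Fin (n + 2)) ℝ (E n) := ⟨s.points, s.independent, htop⟩
  have hBs : ∀ i, B i = s.points i := fun _ => rfl
  have hC : convexHull ℝ (latticePoint '' V) = convexHull ℝ (Set.range B) := hs
  -- If a vertex were not among the generators, its barycentric coordinate would be less than `1` on
  -- all of them, and then on their convex hull.
  have hvert : ∀ i, ∃ a ∈ V, s.points i = latticePoint a := by
    intro i
    by_contra hcon
    push Not at hcon
    have hlt : convexHull ℝ (latticePoint '' V) ⊆ {z | B.coord i z < 1} := by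
      refine convexHull_min ?_ ?_
      · rintro _ ⟨a, ha, rfl⟩
        have haC : latticePoint a ∈ convexHull ℝ (Set.range B) :=
          hC ▸ subset_convexHull ℝ _ (Set.mem_image_of_mem _ ha)
        exact lt_of_not_ge fun hge => hcon a ha (eq_vertex_of_one_le_coord B haC hge).symm
      · exact (convex_Iio (1 : ℝ)).affine_preimage (B.coord i)
    have hmem : B i ∈ convexHull ℝ (latticePoint '' V) :=
      hC ▸ subset_convexHull ℝ _ (Set.mem_range_self i)
    have := hlt hmem
    simp at this
  choose a haV ha using hvert
  have hb : ∀ i, B i = latticePoint (a i) := ha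
  have hvol' := hC ▸ hvol
  obtain ⟨i, rfl⟩ := exists_eq_vertex a B hb hvol' (hC ▸ hx)
  refine ⟨haV i, (InnerProductSpace.toDual ℝ (E n)).symm (B.coord i).linear.toContinuousLinearMap,
    fun y hy hne => ?_⟩
  obtain ⟨j, rfl⟩ := exists_eq_vertex a B hb hvol'
    (hC ▸ subset_convexHull ℝ _ (Set.mem_image_of_mem _ hy))
  have hij : i ≠ j := fun h => hne (h ▸ rfl)
  rw [real_inner_comm, InnerProductSpace.toDual_symm_apply, LinearMap.coe_toContinuousLinearMap',
    ← vsub_eq_sub, AffineMap.linearMap_vsub, ← hb, ← hb, B.coord_apply_eq, B.coord_apply_ne hij]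
  simp

theorem IsUnimodularSimplex.nonempty_interior {C : Set (E n)} (h : IsUnimodularSimplex C) :
    (interior C).Nonempty := by
  obtain ⟨⟨s, rfl⟩, -⟩ := h
  rw [interior_convexHull_nonempty_iff_affineSpan_eq_top,
    s.independent.affineSpan_eq_top_iff_card_eq_finrank_add_one]
  simp

/-! ### The cells of the subdivision -/

/-- A point of a convex hull at which a linear functional attains its maximum `m` lies in the convex
hull of the generators at which it does. -/
theorem mem_convexHull_of_eq_max {V : Type*} [AddCommGroup V] [Module ℝ V] {S : Set V}
    (l : V →ₗ[ℝ] ℝ) {m : ℝ} (hS : ∀ z ∈ S, l z ≤ m) {z : V} (hz : z ∈ convexHull ℝ S) :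
    l z ≤ m ∧ (l z = m → z ∈ convexHull ℝ {z ∈ S | l z = m}) := by
  refine convexHull_min (t := {z | l z ≤ m ∧ (l z = m → z ∈ convexHull ℝ {z ∈ S | l z = m})})
    (fun z hz => ⟨hS z hz, fun h => subset_convexHull ℝ _ ⟨hz, h⟩⟩) ?_ hz
  rw [convex_iff_forall_pos]
  rintro x ⟨hx, hx'⟩ y ⟨hy, hy'⟩ s t hs ht hst
  have hl : l (s • x + t • y) = s * l x + t * l y := by simp
  have hsx : s * l x ≤ s * m := mul_le_mul_of_nonneg_left hx hs.le
  have hty : t * l y ≤ t * m := mul_le_mul_of_nonneg_left hy ht.le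
  have hm : s * m + t * m = m := by rw [← add_mul, hst, one_mul]
  refine ⟨by rw [hl]; linarith, fun h => ?_⟩
  rw [hl] at h
  have hxm : l x = m := mul_left_cancel₀ hs.ne' (by linarith)
  have hym : l y = m := mul_left_cancel₀ ht.ne' (by linarith)
  exact convex_convexHull ℝ _ (hx' hxm) (hy' hym) hs.le ht.le hst

/-- The lattice points whose terms attain the maximum at `y`. -/
noncomputable def activeSet (A : Finset (Fin (n + 1) → ℤ)) (v : (Fin (n + 1) → ℤ) → ℝ) (y : E n) :
    Set (Fin (n + 1) → ℤ) :=
  {a | a ∈ A ∧ y ∈ region A v a}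

/-- The cell of the subdivision that is dual to the stratum of `y`. -/
noncomputable def dualCell (A : Finset (Fin (n + 1) → ℤ)) (v : (Fin (n + 1) → ℤ) → ℝ) (y : E n) :
    Set (E n) :=
  convexHull ℝ (latticePoint '' activeSet A v y)

theorem activeSet_subset (y : E n) : activeSet A v y ⊆ A := fun _ h => h.1

theorem dualCell_subset (y : E n) : dualCell A v y ⊆ newtonPolyhedron A :=
  convexHull_mono (Set.image_mono (activeSet_subset y))

theorem finite_range_dualCell : (Set.range (dualCell A v)).Finite := by
  refine ((A.finite_toSet.finite_subsets).image
    fun s : Set (Fin (n + 1) → ℤ) => convexHull ℝ (latticePoint '' s)).subset ?_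
  rintro _ ⟨y, rfl⟩
  exact ⟨_, activeSet_subset y, rfl⟩

/-- The functional on `E n × ℝ` whose maximum on the overgraph is the Legendre transform at `y`. -/
noncomputable def heightFunctional (y : E n) : StrongDual ℝ (E n × ℝ) :=
  (innerSL ℝ y).comp (ContinuousLinearMap.fst ℝ (E n) ℝ) - ContinuousLinearMap.snd ℝ (E n) ℝ

theorem heightFunctional_apply (y : E n) (q : E n × ℝ) :
    heightFunctional y q = inner ℝ y q.1 - q.2 := rfl

theorem heightFunctional_latticePoint (y : E n) (a : Fin (n + 1) → ℤ) :
    heightFunctional y (latticePoint a, v a) = affineTerm v a y := by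
  rw [heightFunctional_apply, affineTerm, real_inner_comm]

theorem latticePoint_mem_overgraph {a : Fin (n + 1) → ℤ} (ha : a ∈ A) :
    (latticePoint a, v a) ∈ overgraph A v := ⟨a, ha, rfl, le_rfl⟩

/-- The face of the polyhedron over the dual cell of `y`. -/
theorem toExposed_heightFunctional (hA : A.Nonempty) (y : E n) :
    (heightFunctional y).toExposed (convexHull ℝ (overgraph A v)) =
      convexHull ℝ ((fun a => (latticePoint a, v a)) '' activeSet A v y) := by
  obtain ⟨a, ha, hya⟩ := exists_mem_region (v := v) hA y
  have hle : ∀ q ∈ overgraph A v, heightFunctional y q ≤ affineTerm v a y := by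
    rintro ⟨x, t⟩ ⟨b, hb, rfl, ht⟩
    have h1 := hya b hb
    rw [← heightFunctional_latticePoint, heightFunctional_apply] at h1
    rw [heightFunctional_apply]
    dsimp only at *
    linarith
  ext q
  constructor
  · rintro ⟨hq, hmax⟩
    have h1 := mem_convexHull_of_eq_max (heightFunctional y : E n × ℝ →ₗ[ℝ] ℝ) hle hq
    have h2 : heightFunctional y q = affineTerm v a y := by
      refine le_antisymm h1.1 ?_
      rw [← heightFunctional_latticePoint]
      exact hmax _ (subset_convexHull ℝ _ (latticePoint_mem_overgraph ha))
    refine convexHull_mono ?_ (h1.2 h2)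
    rintro ⟨x, t⟩ ⟨⟨b, hb, rfl, ht⟩, hbm⟩
    have hbm' : heightFunctional y (latticePoint b, t) = affineTerm v a y := hbm
    have h3 := hya b hb
    rw [heightFunctional_apply] at hbm'
    have h4 := heightFunctional_latticePoint (v := v) y b
    rw [heightFunctional_apply] at h4
    dsimp only at *
    have htv : t = v b := by linarith
    refine ⟨b, ⟨hb, fun c hc => ?_⟩, by rw [htv]⟩
    have := hya c hc
    linarith
  · intro hq
    have hsub : (fun a => (latticePoint a, v a)) '' activeSet A v y ⊆ overgraph A v := by
      rintro _ ⟨b, hb, rfl⟩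
      exact latticePoint_mem_overgraph hb.1
    have hge : affineTerm v a y ≤ heightFunctional y q := by
      refine convexHull_min (t := {q | affineTerm v a y ≤ heightFunctional y q}) ?_
        (convex_halfSpace_ge (heightFunctional y : E n × ℝ →ₗ[ℝ] ℝ).isLinear _) hq
      rintro _ ⟨b, hb, rfl⟩
      change _ ≤ heightFunctional y (latticePoint b, v b)
      rw [heightFunctional_latticePoint]
      exact hb.2 a ha
    refine ⟨convexHull_mono hsub hq, fun z hz => ?_⟩
    exact (mem_convexHull_of_eq_max (heightFunctional y : E n × ℝ →ₗ[ℝ] ℝ) hle hz).1.trans hge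

theorem fst_image_toExposed (hA : A.Nonempty) (y : E n) :
    Prod.fst '' (heightFunctional y).toExposed (convexHull ℝ (overgraph A v)) = dualCell A v y := by
  rw [toExposed_heightFunctional hA, dualCell]
  have h := (LinearMap.fst ℝ (E n) ℝ).image_convexHull
    ((fun a => (latticePoint a, v a)) '' activeSet A v y)
  rw [Set.image_image] at h
  exact h

theorem dualCell_mem_subdivision (hA : A.Nonempty) (y : E n) :
    dualCell A v y ∈ subdivision A v := by
  refine ⟨_, ContinuousLinearMap.toExposed.isExposed (l := heightFunctional y), ?_, ?_,
    (fst_image_toExposed hA y).symm⟩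
  · rw [toExposed_heightFunctional hA]
    obtain ⟨a, ha, hya⟩ := exists_mem_region (v := v) hA y
    exact ⟨_, subset_convexHull ℝ _ ⟨a, ⟨ha, hya⟩, rfl⟩⟩
  · rw [toExposed_heightFunctional hA]
    exact isBounded_convexHull.2 ((A.finite_toSet.subset (activeSet_subset y)).image _).isBounded

/-- The polyhedron is invariant under upward translations. -/
theorem add_mem_convexHull_overgraph {q : E n × ℝ} (hq : q ∈ convexHull ℝ (overgraph A v)) {t : ℝ}
    (ht : 0 ≤ t) : q + (0, t) ∈ convexHull ℝ (overgraph A v) := by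
  refine convexHull_min (t := {q | q + (0, t) ∈ convexHull ℝ (overgraph A v)}) ?_ ?_ hq
  · rintro ⟨x, s⟩ ⟨a, ha, rfl, hs⟩
    exact subset_convexHull ℝ _ ⟨a, ha, by simp, by simpa using add_le_add hs ht⟩
  · exact (convex_convexHull ℝ (overgraph A v)).translate_preimage_left ((0 : E n), t)

/-- A bounded face is cut out by a functional that decreases strictly in the vertical direction. -/
theorem exists_eq_dualCell (hA : A.Nonempty) {C : Set (E n)} (hC : C ∈ subdivision A v) :
    ∃ y, C = dualCell A v y := by
  obtain ⟨F, hF, hne, hbdd, rfl⟩ := hC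
  obtain ⟨l, rfl⟩ := hF hne
  obtain ⟨q, hq, hmax⟩ := hne
  set s := l (0, 1) with hs
  have hl : ∀ (x : E n) (t : ℝ), l (x, t) = l (x, 0) + t * s := by
    intro x t
    have h1 : ((x, t) : E n × ℝ) = (x, 0) + t • (0, 1) := by simp
    rw [h1, map_add, map_smul, smul_eq_mul]
  have hls : ∀ t : ℝ, l (q + (0, t)) = l q + t * s := by
    intro t
    rw [map_add, hl 0 t]
    have h0 : l ((0, 0) : E n × ℝ) = 0 := map_zero l
    rw [h0, zero_add]
  -- A positive `s` would make `l` unbounded on the polyhedron, and `s = 0` the face.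
  have hs0 : s ≤ 0 := by
    have h := hmax _ (add_mem_convexHull_overgraph hq zero_le_one)
    rw [hls] at h
    linarith
  have hs1 : s ≠ 0 := by
    intro h0
    obtain ⟨R, hR⟩ := hbdd.exists_norm_le
    have hmem : q + (0, R + 1 + |q.2|) ∈ l.toExposed (convexHull ℝ (overgraph A v)) := by
      have hR0 : 0 ≤ R := (norm_nonneg _).trans (hR q ⟨hq, hmax⟩)
      refine ⟨add_mem_convexHull_overgraph hq (by positivity), fun z hz => ?_⟩
      rw [hls, h0, mul_zero, add_zero]
      exact hmax z hz
    have h1 := hR _ hmem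
    have h2 : ‖q.2 + (R + 1 + |q.2|)‖ ≤ ‖q + (0, R + 1 + |q.2|)‖ :=
      norm_snd_le (q + (0, R + 1 + |q.2|))
    rw [Real.norm_eq_abs] at h2
    have h3 := le_abs_self (q.2 + (R + 1 + |q.2|))
    have h4 := neg_abs_le q.2
    linarith
  have hsneg : 0 < -s := neg_pos.2 (lt_of_le_of_ne hs0 hs1)
  obtain ⟨w, hw⟩ := (InnerProductSpace.toDual ℝ (E n)).surjective
    (l.comp (ContinuousLinearMap.inl ℝ (E n) ℝ))
  have hwl : ∀ x : E n, l (x, 0) = inner ℝ w x := by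
    intro x
    rw [← InnerProductSpace.toDual_apply_apply, hw]
    simp
  have hscale : ∀ q : E n × ℝ, l q = -s * heightFunctional ((-s)⁻¹ • w) q := by
    rintro ⟨x, t⟩
    rw [hl, hwl, heightFunctional_apply, inner_smul_left]
    simp only [conj_trivial]
    field_simp
    ring
  refine ⟨(-s)⁻¹ • w, ?_⟩
  rw [← fst_image_toExposed hA]
  congr 1
  ext q
  simp only [ContinuousLinearMap.toExposed, Set.mem_ofPred_eq, hscale, mul_le_mul_iff_right₀ hsneg]

/-! ### Lattice points of the polyhedron have open regions -/

/-- At a maximum `y` of the concave function `y ↦ x · y - L y`, which exists for interior `x`,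
the point `x` cannot be separated from the dual cell of `y`. -/
theorem exists_mem_dualCell_of_mem_interior (hA : A.Nonempty) {x : E n}
    (hx : x ∈ interior (newtonPolyhedron A)) : ∃ y, x ∈ dualCell A v y := by
  have hcont : Continuous (legendre A hA v) :=
    Continuous.finset_sup'_apply hA fun a _ => continuous_affineTerm
  obtain ⟨δ, hδ, hball⟩ := Metric.mem_nhds_iff.1 (mem_interior_iff_mem_nhds.1 hx)
  obtain ⟨K, hK⟩ : ∃ K, ∀ a ∈ A, v a ≤ K := (A.image v).finite_toSet.bddAbove.imp fun K hK a ha =>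
    hK (Finset.mem_coe.2 (Finset.mem_image_of_mem v ha))
  have hbound : ∀ y : E n, inner ℝ x y - legendre A hA v y ≤ K - δ / 2 * ‖y‖ := by
    intro y
    have hmem : x + (δ / 2 * ‖y‖⁻¹) • y ∈ newtonPolyhedron A := by
      refine hball ?_
      rw [Metric.mem_ball, dist_self_add_left, norm_smul, norm_mul, norm_inv, norm_norm,
        Real.norm_eq_abs, abs_of_pos (half_pos hδ), mul_assoc]
      have h1 : ‖y‖⁻¹ * ‖y‖ ≤ 1 := inv_mul_le_one
      nlinarith
    have hle : newtonPolyhedron A ⊆ {z | inner ℝ y z ≤ legendre A hA v y + K} := by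
      refine convexHull_min ?_ (convex_halfSpace_le (innerₗ (E n) y).isLinear _)
      rintro _ ⟨a, ha, rfl⟩
      have h1 := affineTerm_le_legendre (v := v) hA (y := y) ha
      have h2 := hK a ha
      rw [affineTerm, real_inner_comm] at h1
      change inner ℝ y (latticePoint a) ≤ _
      linarith
    have h2 := hle hmem
    rw [Set.mem_ofPred_eq, inner_add_right, inner_smul_right, real_inner_self_eq_norm_sq,
      real_inner_comm] at h2
    have h3 : δ / 2 * ‖y‖⁻¹ * ‖y‖ ^ 2 = δ / 2 * ‖y‖ := by
      by_cases hy : ‖y‖ = 0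
      · simp [hy]
      · field_simp
    linarith
  have hlim : Filter.Tendsto (fun y : E n => legendre A hA v y - inner ℝ x y)
      (Filter.cocompact (E n)) Filter.atTop := by
    have h1 : Filter.Tendsto (fun y : E n => δ / 2 * ‖y‖ - K) (Filter.cocompact (E n))
        Filter.atTop :=
      Filter.tendsto_atTop_add_const_right _ (-K)
        ((tendsto_norm_cocompact_atTop (E := E n)).const_mul_atTop (half_pos hδ))
    exact Filter.tendsto_atTop_mono (fun y => by linarith [hbound y]) h1
  obtain ⟨y, hy⟩ := (hcont.sub (by fun_prop : Continuous fun y : E n => inner ℝ x y)).exists_forall_le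
    hlim
  refine ⟨y, ?_⟩
  by_contra hxy
  have hclosed : IsClosed (dualCell A v y) :=
    (((A.finite_toSet.subset (activeSet_subset y)).image _).isCompact_convexHull ℝ).isClosed
  obtain ⟨f, r, hf, hr⟩ := geometric_hahn_banach_closed_point (convex_convexHull ℝ _) hclosed hxy
  obtain ⟨d, rfl⟩ := (InnerProductSpace.toDual ℝ (E n)).surjective f
  simp only [InnerProductSpace.toDual_apply_apply] at hf hr
  -- A small step in the direction `d` increases `x · y` by more than each of the terms that can
  -- become maximal.
  have hev : ∀ᶠ t in nhdsWithin (0 : ℝ) (Set.Ioi 0), ∀ a ∈ A,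
      affineTerm v a (y + t • d) < legendre A hA v y + t * inner ℝ x d := by
    rw [Filter.eventually_all_finset]
    intro a ha
    by_cases hya : y ∈ region A v a
    · have h1 : inner ℝ d (latticePoint a) < inner ℝ d x :=
        (hf _ (subset_convexHull ℝ _ ⟨a, ⟨ha, hya⟩, rfl⟩)).trans hr
      filter_upwards [self_mem_nhdsWithin] with t ht
      rw [legendre_eq hA ha hya, affineTerm, affineTerm, inner_add_right, inner_smul_right,
        real_inner_comm d x, real_inner_comm d (latticePoint a)]
      have := mul_lt_mul_of_pos_left h1 ht
      linarith
    · have h1 : affineTerm v a y < legendre A hA v y :=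
        lt_of_le_of_ne (affineTerm_le_legendre hA ha)
          fun h => hya (mem_region_of_legendre_eq hA h.symm)
      have h2 : ContinuousAt (fun t : ℝ => affineTerm v a (y + t • d)) 0 :=
        (continuous_affineTerm.comp (by fun_prop)).continuousAt
      have h3 : ContinuousAt (fun t : ℝ => legendre A hA v y + t * inner ℝ x d) 0 := by fun_prop
      exact (h2.eventually_lt h3 (by simpa using h1)).filter_mono nhdsWithin_le_nhds
  obtain ⟨t, ht⟩ := hev.exists
  have h1 : legendre A hA v y - inner ℝ x y ≤
      legendre A hA v (y + t • d) - inner ℝ x (y + t • d) := hy (y + t • d)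
  obtain ⟨a, ha, hm⟩ := exists_mem_region (v := v) hA (y + t • d)
  have h2 := ht a ha
  rw [legendre_eq hA ha hm, inner_add_right, inner_smul_right] at h1
  linarith

/-- A maximal cell exists above each cell, since there are only finitely many. -/
theorem exists_maximal_dualCell (hA : A.Nonempty) (y : E n) :
    ∃ z, dualCell A v y ⊆ dualCell A v z ∧ Maximal (· ∈ subdivision A v) (dualCell A v z) := by
  obtain ⟨C, hle, hmax⟩ := (finite_range_dualCell (A := A) (v := v)).exists_le_maximal
    (Set.mem_range_self y)
  obtain ⟨z, rfl⟩ := hmax.prop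
  refine ⟨z, hle, dualCell_mem_subdivision hA z, fun C hC h => ?_⟩
  obtain ⟨w, rfl⟩ := exists_eq_dualCell hA hC
  exact hmax.le_of_ge (Set.mem_range_self w) h

theorem nonempty_interior_newtonPolyhedron (hA : A.Nonempty)
    (hU : IsUnimodular (subdivision A v)) : (interior (newtonPolyhedron A)).Nonempty := by
  obtain ⟨z, -, hz⟩ := exists_maximal_dualCell (v := v) hA 0
  exact (hU _ hz).nonempty_interior.mono (interior_mono (dualCell_subset z))

/-- The dual cells cover `Δ`: they cover its interior, and there are only finitely many. -/
theorem exists_mem_dualCell (hA : A.Nonempty) (hint : (interior (newtonPolyhedron A)).Nonempty)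
    {x : E n} (hx : x ∈ newtonPolyhedron A) : ∃ y, x ∈ dualCell A v y := by
  have hclosed : IsClosed (⋃₀ Set.range (dualCell A v)) := by
    rw [Set.sUnion_eq_biUnion]
    refine finite_range_dualCell.isClosed_biUnion ?_
    rintro _ ⟨y, rfl⟩
    exact (((A.finite_toSet.subset (activeSet_subset y)).image _).isCompact_convexHull ℝ).isClosed
  have hconv : Convex ℝ (newtonPolyhedron A) := convex_convexHull ℝ _
  have hx' : x ∈ closure (interior (newtonPolyhedron A)) := by
    rw [hconv.closure_interior_eq_closure_of_nonempty_interior hint]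
    exact subset_closure hx
  have hsub : interior (newtonPolyhedron A) ⊆ ⋃₀ Set.range (dualCell A v) := by
    intro z hz
    obtain ⟨y, hy⟩ := exists_mem_dualCell_of_mem_interior (v := v) hA hz
    exact ⟨_, ⟨y, rfl⟩, hy⟩
  obtain ⟨_, ⟨y, rfl⟩, hy⟩ := closure_minimal hsub hclosed hx'
  exact ⟨y, hy⟩

/-- In a unimodular triangulation all lattice points of `Δ` are vertices, so they occur in `A` and
their terms are somewhere larger than all the others. -/
theorem mem_and_nonempty_openRegion (hA : A.Nonempty) (hU : IsUnimodular (subdivision A v))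
    {x : Fin (n + 1) → ℤ} (hx : latticePoint x ∈ newtonPolyhedron A) :
    x ∈ A ∧ (openRegion A v x).Nonempty := by
  obtain ⟨y, hy⟩ := exists_mem_dualCell (v := v) hA (nonempty_interior_newtonPolyhedron hA hU) hx
  obtain ⟨z, hyz, hz⟩ := exists_maximal_dualCell (v := v) hA y
  obtain ⟨⟨hxA, hxz⟩, d, hd⟩ := (hU _ hz).exists_direction (hyz hy)
  have hev : ∀ᶠ t in nhdsWithin (0 : ℝ) (Set.Ioi 0), ∀ b ∈ A, b ≠ x →
      0 < gap v x b (z + t • d) := by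
    rw [Filter.eventually_all_finset]
    intro b hb
    rw [Filter.eventually_imp_distrib_left]
    intro hbx
    by_cases hzb : z ∈ region A v b
    · filter_upwards [self_mem_nhdsWithin] with t ht
      rw [gap_add, inner_smul_right]
      exact add_pos_of_nonneg_of_pos (sub_nonneg.2 (hxz b hb)) (mul_pos ht (hd b ⟨hb, hzb⟩ hbx))
    · have h1 : 0 < gap v x b z := by
        refine sub_pos.2 (lt_of_not_ge fun h => hzb fun c hc => (hxz c hc).trans h)
      have h2 : ContinuousAt (fun t : ℝ => gap v x b (z + t • d)) 0 :=
        (continuous_gap.comp (by fun_prop)).continuousAt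
      exact (continuousAt_const.eventually_lt h2 (by simpa using h1)).filter_mono nhdsWithin_le_nhds
  obtain ⟨t, ht⟩ := hev.exists
  exact ⟨hxA, z + t • d, fun b hb hbx => sub_pos.1 (ht b hb hbx)⟩

/-! ### The choice of the punctures -/

theorem exists_injective_mem_of_infinite {ι α : Type*} [Finite ι] (S : ι → Set α)
    (hS : ∀ i, (S i).Infinite) : ∃ f : ι → α, Function.Injective f ∧ ∀ i, f i ∈ S i := by
  classical
  have := Fintype.ofFinite ι
  choose t hts htc using fun i => (hS i).exists_subset_card_eq (Fintype.card ι)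
  obtain ⟨f, hf, hft⟩ := (Finset.all_card_le_biUnion_card_iff_exists_injective t).1 fun s => by
    rcases s.eq_empty_or_nonempty with rfl | ⟨i, hi⟩
    · simp
    · exact s.card_le_univ.trans ((htc i).ge.trans
        (Finset.card_le_card (Finset.subset_biUnion_of_mem t hi)))
  exact ⟨f, hf, fun i => hts i (hft i)⟩

/-- In an open set, the zeroth coordinates of the inversions of the points take infinitely many
values: moving a point along the ray from the origin changes this coordinate. -/
theorem infinite_heights {U : Set (E n)} (hU : IsOpen U) {o p : E n} (hp : p ∈ U)
    (hpos : 0 < (p + o) 0) :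
    {τ : ℝ | 0 < τ ∧ ∃ q ∈ U, unitInversion (q + o) 0 = τ}.Infinite := by
  have hne : p + o ≠ 0 := by
    intro h
    rw [h] at hpos
    simp at hpos
  have hθ : 0 < unitInversion (p + o) 0 := by
    rw [unitInversion_apply_zero]
    exact mul_pos (inv_pos.2 (pow_pos (norm_pos_iff.2 hne) 2)) hpos
  have hcont : Continuous fun s : ℝ => s • (p + o) - o := by fun_prop
  -- Multiplying `p + o` by `s` divides the zeroth coordinate of its inversion by `s`.
  have hnhds : {s : ℝ | 0 < s ∧ s • (p + o) - o ∈ U} ∈ nhds (1 : ℝ) :=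
    Filter.inter_mem (lt_mem_nhds zero_lt_one)
      (hcont.continuousAt.preimage_mem_nhds (by simpa using hU.mem_nhds hp))
  refine ((infinite_of_mem_nhds (1 : ℝ) hnhds).image
    (f := fun s => s⁻¹ * unitInversion (p + o) 0) ?_).mono ?_
  · intro s _ t _ hst
    exact inv_injective (mul_right_cancel₀ hθ.ne' hst)
  · rintro _ ⟨s, ⟨hs, hsU⟩, rfl⟩
    refine ⟨mul_pos (inv_pos.2 hs) hθ, _, hsU, ?_⟩
    rw [sub_add_cancel, unitInversion_smul]
    rfl

/-- Points whose inversions have different positive zeroth coordinates can be ordered by these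
coordinates and separated. -/
theorem exists_separatedPoints {ι : Type*} [Finite ι] (q : ι → E n)
    (hpos : ∀ i, 0 < unitInversion (q i) 0)
    (hinj : Function.Injective fun i => unitInversion (q i) 0) :
    ∃ D : SeparatedPoints n (Nat.card ι), Set.range D.p = Set.range q := by
  set τ : ι → ℝ := fun i => unitInversion (q i) 0 with hτ
  -- The order on the indices is that of the heights.
  let e₀ : Fin (Nat.card ι) ≃ ι := (Finite.equivFin ι).symm
  let e : Fin (Nat.card ι) ≃ ι := (Tuple.sort (τ ∘ e₀)).trans e₀
  have hmono : StrictMono (τ ∘ e) :=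
    Monotone.strictMono_of_injective (Tuple.monotone_sort (τ ∘ e₀)) (hinj.comp e.injective)
  have hsep : ∀ i, ∃ h, 0 < h ∧ h < τ (e i) ∧ ∀ j, j < i → τ (e j) < h := by
    intro i
    have h1 : ∀ᶠ h in nhdsWithin (τ (e i)) (Set.Iio (τ (e i))), ∀ j, j < i → τ (e j) < h := by
      refine Filter.eventually_all.2 fun j => Filter.eventually_imp_distrib_left.2 fun hj => ?_
      exact nhdsWithin_le_nhds (lt_mem_nhds (hmono hj))
    have h2 : ∀ᶠ h in nhdsWithin (τ (e i)) (Set.Iio (τ (e i))), 0 < h :=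
      nhdsWithin_le_nhds (lt_mem_nhds (hpos (e i)))
    obtain ⟨h, ⟨h1, h2⟩, h3⟩ := ((h1.and h2).and self_mem_nhdsWithin).exists
    exact ⟨h, h2, h3, h1⟩
  choose h h0 h1 h2 using hsep
  exact ⟨⟨q ∘ e, h, h0, h1, fun i j hij => h2 j i hij⟩, e.surjective.range_comp q⟩

/-- Given finitely many open sets, one can choose a point in each of them so that the complement of
these points is a bouquet: after a translation that makes the zeroth coordinates positive, the
inversions of generic points have different heights. -/
theorem exists_mem_and_nonempty_homotopyEquiv {ι : Type*} [Finite ι] (U : ι → Set (E n))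
    (hU : ∀ i, IsOpen (U i)) (hne : ∀ i, (U i).Nonempty) :
    ∃ p : ι → E n, (∀ i, p i ∈ U i) ∧ Nonempty (ContinuousMap.HomotopyEquiv
      ((Set.range p)ᶜ : Set (E n)) (Bouquet n (Nat.card ι))) := by
  choose p₀ hp₀ using hne
  obtain ⟨R, hR⟩ := (Set.finite_range fun i => -p₀ i 0).bddAbove
  let o : E n := EuclideanSpace.single 0 (R + 1)
  have hpos : ∀ i, 0 < (p₀ i + o) 0 := by
    intro i
    have h1 : -p₀ i 0 ≤ R := hR ⟨i, rfl⟩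
    have h2 : (p₀ i + o) 0 = p₀ i 0 + (R + 1) := by simp [o]
    rw [h2]
    linarith
  obtain ⟨τ, hτ, hτS⟩ := exists_injective_mem_of_infinite _
    fun i => infinite_heights (hU i) (hp₀ i) (hpos i)
  choose hτ0 p hpU hpτ using hτS
  obtain ⟨D, hD⟩ := exists_separatedPoints (fun i => p i + o) (fun i => (hpτ i).symm ▸ hτ0 i)
    (by simpa only [hpτ] using hτ)
  obtain ⟨f⟩ := D.nonempty_homotopyEquiv_bouquet
  have hmem : ∀ y : E n, y ∈ (Set.range p)ᶜ ↔ y + o ∈ (Set.range D.p)ᶜ := by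
    intro y
    rw [hD]
    simp
  exact ⟨p, hpU, ⟨((Homeomorph.addRight o).subtype hmem).toHomotopyEquiv.trans f⟩⟩

end TropicalComplex

theorem mainTheorem9 (n : ℕ) (Δ P : Set (TropicalComplex.E n))
    (hP : TropicalComplex.IsMaximalDualComplex Δ P) :
    (TropicalComplex.interiorLatticePoints Δ).Finite ∧
      Nonempty (ContinuousMap.HomotopyEquiv P
        (TropicalComplex.Bouquet n (TropicalComplex.interiorLatticePoints Δ).ncard)) := by
  obtain ⟨A, hA, v, rfl, rfl, hU⟩ := hP
  have hmem : ∀ a : Fin (n + 1) → ℤ, TropicalComplex.latticePoint a ∈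
      TropicalComplex.newtonPolyhedron A → a ∈ A ∧ (TropicalComplex.openRegion A v a).Nonempty :=
    fun a => TropicalComplex.mem_and_nonempty_openRegion hA hU
  have hI : TropicalComplex.interiorLatticePoints (TropicalComplex.newtonPolyhedron A) ⊆ A :=
    fun a ha => (hmem a (interior_subset ha)).1
  have hfin := A.finite_toSet.subset hI
  have := hfin.to_subtype
  obtain ⟨p, hp, ⟨f⟩⟩ := TropicalComplex.exists_mem_and_nonempty_homotopyEquiv
    (fun a : TropicalComplex.interiorLatticePoints (TropicalComplex.newtonPolyhedron A) =>
      TropicalComplex.openRegion A v a)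
    (fun a => TropicalComplex.isOpen_openRegion)
    (fun a => (hmem a (interior_subset a.2)).2)
  obtain ⟨e⟩ := TropicalComplex.nonempty_homotopyEquiv_cornerLocus hA
    (TropicalComplex.nonempty_interior_newtonPolyhedron hA hU)
    (fun a ha => (hmem a (subset_convexHull ℝ _ (Set.mem_image_of_mem _ ha))).2) hI p hp
  rw [← Nat.card_coe_set_eq]
  exact ⟨hfin, ⟨e.trans f⟩⟩
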